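/- An instance of the unweighted Label $s$-$t$ Cut problem consists of a finite simple graph $G=(V,E)$, directed or undirected (no loops, at most one edge for each ordered, respectively unordered, pair of vertices), two distinct vertices $s,t\in V$, a non-empty finite label set $L$, and a label $\ell(e)\in L$ for every edge $e\in E$. A set $L'\subseteq L$ is feasible if removing all edges with labels in $L'$ leaves no $s$-$t$ path; $\mathrm{OPT}$ is the minimum size of a feasible set. Put $n=|V|$, $q=|L|$, and for $E'\subseteq E$ let $L(E')=\{\ell(e):e\in E'\}$. For an integer $k\ge 1$ (the guess of $\mathrm{OPT}$) consider the following algorithm. Stage one: start with $L_1=\emptyset$; while the $s$-$t$ distance in the current graph is at most $n^{2/3}/k^{1/3}$, choose a shortest $s$-$t$ path $P$, remove all edges whose labels are in $L(P)$, and replace $L_1$ by $L_1\cup L(P)$. (The distance is $\infty$ if there is no $s$-$t$ path.) Stage two: choose a minimum size $s$-$t$ edge cut $E'$ of the remaining graph and return $L_1\cup L(E')$. The complete algorithm does this for every $k\in\{1,\dots,q\}$ and returns a smallest one of the $q$ sets obtained. Theorem. The algorithm is a polynomial-time $O(n^{2/3}/\mathrm{OPT}^{1/3})$-approximation algorithm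 for unweighted Label $s$-$t$ Cut on simple directed or undirected graphs. Precisely: 1. There is an absolute constant $C>0$ such that for every instance, and for every choice of the shortest paths and of the minimum cuts: if $\mathrm{OPT}\ge 1$, every set $X$ returned for the correct guess $k=\mathrm{OPT}$ is feasible and satisfies $|X|\le C\,\frac{n^{2/3}}{\mathrm{OPT}^{1/3}}\cdot\mathrm{OPT}$. Every set $X$ returned by the complete algorithm is feasible, satisfies the same bound if $\mathrm{OPT}\ge1$, and is empty if $\mathrm{OPT}=0$. 2. For every instance, every guess $k\ge1$ and every choice of the shortest paths, the while loop makes at most $q$ iterations. 3. The complete algorithm can be carried out in time polynomial in $n+q$: there is a single program for a random access machine with unit-cost addition, truncated subtraction, zero tests and array access which, given any instance as $n,q,s,t$, a flag telling whether the graph is directed, and the labelled adjacency matrix, halts within $c\,(n+q)^d$ steps, for constants $c,d$ that do not depend on the instance, and outputs a set that the complete algorithm may return. -/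

import Mathlib

/-! ## A random access machine with unit cost, given as a structured language

The machine has scalar registers and named two-dimensional arrays, all holding natural numbers.
The arithmetic operations are addition and truncated subtraction only, so that in `T` steps
the bit length of the numbers grows by at most `T` and unit cost is polynomially related to
Turing machine time. A program is a finite syntax tree, independent of the input. -/

namespace Ram

structure Store where
  var : ℕ → ℕ
  mem : ℕ → ℕ → ℕ → ℕ

inductive Expr : Type
  | lit (c : ℕ)
  | var (x : ℕ)
  | get (a : ℕ) (i j : Expr)
  | add (e f : Expr)
  | sub (e f : Expr)

namespace Expr

def eval (σ : Store) : Expr → ℕ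
  | lit c => c
  | var x => σ.var x
  | get a i j => σ.mem a (i.eval σ) (j.eval σ)
  | add e f => e.eval σ + f.eval σ
  | sub e f => e.eval σ - f.eval σ

/-- The number of operations needed to evaluate an expression: its number of nodes. -/
def cost : Expr → ℕ
  | lit _ => 1
  | var _ => 1
  | get _ i j => i.cost + j.cost + 1
  | add e f => e.cost + f.cost + 1
  | sub e f => e.cost + f.cost + 1

end Expr

/-- Programs. A test `e` succeeds when the value of `e` is not `0`. -/
inductive Cmd : Type
  | skip
  | set (x : ℕ) (e : Expr)
  | put (a : ℕ) (i j e : Expr)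
  | seq (c d : Cmd)
  | ite (e : Expr) (c d : Cmd)
  | loop (e : Expr) (c : Cmd)

def Store.setVar (σ : Store) (x v : ℕ) : Store where
  var := fun y => if y = x then v else σ.var y
  mem := σ.mem

def Store.putMem (σ : Store) (a i j v : ℕ) : Store where
  var := σ.var
  mem := fun a' i' j' => if a' = a ∧ i' = i ∧ j' = j then v else σ.mem a' i' j'

/-- `Exec c σ T σ'`: started in `σ`, the program `c` halts in `σ'` after exactly `T` steps. -/
inductive Exec : Cmd → Store → ℕ → Store → Prop
  | skip (σ : Store) : Exec .skip σ 1 σ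
  | set (σ : Store) (x : ℕ) (e : Expr) :
      Exec (.set x e) σ (e.cost + 1) (σ.setVar x (e.eval σ))
  | put (σ : Store) (a : ℕ) (i j e : Expr) :
      Exec (.put a i j e) σ (i.cost + j.cost + e.cost + 1)
        (σ.putMem a (i.eval σ) (j.eval σ) (e.eval σ))
  | seq {c d : Cmd} {σ ρ τ : Store} {T U : ℕ} :
      Exec c σ T ρ → Exec d ρ U τ → Exec (.seq c d) σ (T + U) τ
  | iteTrue {e : Expr} {c d : Cmd} {σ τ : Store} {T : ℕ} :
      e.eval σ ≠ 0 → Exec c σ T τ → Exec (.ite e c d) σ (e.cost + T + 1) τ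
  | iteFalse {e : Expr} {c d : Cmd} {σ τ : Store} {T : ℕ} :
      e.eval σ = 0 → Exec d σ T τ → Exec (.ite e c d) σ (e.cost + T + 1) τ
  | loopStop {e : Expr} {c : Cmd} {σ : Store} :
      e.eval σ = 0 → Exec (.loop e c) σ (e.cost + 1) σ
  | loopStep {e : Expr} {c : Cmd} {σ ρ τ : Store} {T U : ℕ} :
      e.eval σ ≠ 0 → Exec c σ T ρ → Exec (.loop e c) ρ U τ →
        Exec (.loop e c) σ (e.cost + T + U + 1) τ

end Ram

/-! ## The Label `s`-`t` Cut problem and the two-stage algorithm -/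

namespace LabelCut

/-- A simple graph on the vertices `0, …, n - 1`, undirected or directed. -/
inductive Network (n : ℕ) : Type
  | undirected (G : SimpleGraph (Fin n))
  | directed (D : Digraph (Fin n)) (loopless : ∀ v, ¬ D.Adj v v)

namespace Network

def Edge {n : ℕ} : Network n → Type
  | undirected G => G.edgeSet
  | directed D _ => {p : Fin n × Fin n // D.Adj p.1 p.2}

/-- The edge `e` can be traversed from `u` to `v`. -/
def Joins {n : ℕ} : (N : Network n) → N.Edge → Fin n → Fin n → Prop
  | undirected _, e, u, v => e.1 = s(u, v)
  | directed _ _, e, u, v => e.1 = (u, v)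

/-- `1` for a directed graph and `0` for an undirected one. -/
def kind {n : ℕ} : Network n → ℕ
  | undirected _ => 0
  | directed _ _ => 1

end Network

/-- An instance with `n` vertices and `q` labels. -/
structure Instance where
  n : ℕ
  q : ℕ
  q_pos : 0 < q
  graph : Network n
  s : Fin n
  t : Fin n
  s_ne_t : s ≠ t
  label : graph.Edge → Fin q

namespace Instance

variable (I : Instance)

abbrev Edge : Type := I.graph.Edge

/-- `I.Walk S u v P`: the list `P` is the sequence of edges of a walk from `u` to `v` in the
graph whose edge set is `S`. -/
inductive Walk (S : Set I.Edge) : Fin I.n → Fin I.n → List I.Edge → Prop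
  | nil (v : Fin I.n) : Walk S v v []
  | cons {u v w : Fin I.n} {e : I.Edge} {P : List I.Edge} :
      e ∈ S → I.graph.Joins e u v → Walk S v w P → Walk S u w (e :: P)

/-- `s` and `t` are disconnected in the graph with edge set `S`. -/
def Disconnected (S : Set I.Edge) : Prop :=
  ∀ P, ¬ I.Walk S I.s I.t P

/-- A feasible solution: removing all edges with labels in `X` disconnects `s` and `t`. -/
def IsLabelCut (X : Set (Fin I.q)) : Prop :=
  I.Disconnected {e | I.label e ∉ X}

/-- The minimum size of a feasible solution. -/
noncomputable def opt : ℕ :=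
  sInf {c | ∃ X : Set (Fin I.q), I.IsLabelCut X ∧ X.ncard = c}

/-- `P` is a shortest `s`-`t` path in the graph with edge set `S`
(a walk of minimum length is a path). -/
def IsShortestPath (S : Set I.Edge) (P : List I.Edge) : Prop :=
  I.Walk S I.s I.t P ∧ ∀ Q, I.Walk S I.s I.t Q → P.length ≤ Q.length

/-- The labels on the edges in `F`. -/
def labels (F : Set I.Edge) : Set (Fin I.q) := I.label '' F

/-- `F` is a minimum size `s`-`t` edge cut in the graph with edge set `S`. -/
def IsMinCut (S F : Set I.Edge) : Prop :=
  F ⊆ S ∧ I.Disconnected (S \ F) ∧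
    ∀ F' ⊆ S, I.Disconnected (S \ F') → F.ncard ≤ F'.ncard

/-- The distance threshold `n ^ (2/3) / k ^ (1/3)` for the guess `k` of the optimum. -/
noncomputable def threshold (k : ℕ) : ℝ :=
  (I.n : ℝ) ^ (2 / 3 : ℝ) / (k : ℝ) ^ (1 / 3 : ℝ)

/-- `I.StageOne k h S A`: after `h` iterations of the while loop with the guess `k`, for some
choice of the shortest paths, the remaining edges are `S` and the collected labels are `A`. -/
inductive StageOne (k : ℕ) : ℕ → Set I.Edge → Set (Fin I.q) → Prop
  | start : StageOne k 0 Set.univ ∅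
  | step {h : ℕ} {S : Set I.Edge} {A : Set (Fin I.q)} {P : List I.Edge} :
      StageOne k h S A → I.IsShortestPath S P → (P.length : ℝ) ≤ I.threshold k →
        StageOne k (h + 1) {e ∈ S | I.label e ∉ I.labels {f | f ∈ P}}
          (A ∪ I.labels {f | f ∈ P})

/-- `I.Run k X`: with the guess `k`, for some choice of the shortest paths and of the minimum
cut, the algorithm returns `X`. The loop is left when the `s`-`t` distance (infinite if there is
no `s`-`t` path) exceeds the threshold. -/
def Run (k : ℕ) (X : Set (Fin I.q)) : Prop :=
  ∃ (h : ℕ) (S : Set I.Edge) (A : Set (Fin I.q)) (F : Set I.Edge),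
    I.StageOne k h S A ∧ (∀ P, I.Walk S I.s I.t P → I.threshold k < (P.length : ℝ)) ∧
      I.IsMinCut S F ∧ X = A ∪ I.labels F

/-- The whole algorithm: run it for each guess in `{1, …, q}` and return a smallest one among
the `q` solutions found. -/
def Returns (X : Set (Fin I.q)) : Prop :=
  ∃ Y : ℕ → Set (Fin I.q), (∀ k ∈ Finset.Icc 1 I.q, I.Run k (Y k)) ∧
    ∃ k ∈ Finset.Icc 1 I.q, X = Y k ∧ ∀ j ∈ Finset.Icc 1 I.q, (Y k).ncard ≤ (Y j).ncard

/-- `X` has at most `C * (n ^ (2/3) / OPT ^ (1/3)) * OPT` labels. -/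
def WithinRatio (C : ℝ) (X : Set (Fin I.q)) : Prop :=
  (X.ncard : ℝ) ≤ C * ((I.n : ℝ) ^ (2 / 3 : ℝ) / (I.opt : ℝ) ^ (1 / 3 : ℝ)) * (I.opt : ℝ)

open Classical in
/-- The entry of the labelled adjacency matrix at `(u, v)`: `0` if no edge goes from `u` to `v`,
and `ℓ + 1` if the (unique) edge from `u` to `v` has the label `ℓ`. -/
noncomputable def entry (u v : ℕ) : ℕ :=
  if h : ∃ e : I.Edge, ∃ x y : Fin I.n, (x : ℕ) = u ∧ (y : ℕ) = v ∧ I.graph.Joins e x y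
  then (I.label h.choose : ℕ) + 1 else 0

/-- The initial store: registers `0` to `4` hold `n`, `q`, `s`, `t` and the kind of the graph,
array `0` holds the labelled adjacency matrix; everything else is `0`. -/
noncomputable def input : Ram.Store where
  var := fun x =>
    match x with
    | 0 => I.n
    | 1 => I.q
    | 2 => I.s
    | 3 => I.t
    | 4 => I.graph.kind
    | _ => 0
  mem := fun a u v => if a = 0 then I.entry u v else 0

/-- The label set written in a final store: the support of row `0` of array `1`. -/
def output (σ : Ram.Store) : Set (Fin I.q) :=
  {ℓ | σ.mem 1 0 ℓ ≠ 0}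

end Instance

end LabelCut

/-! Approximation. Let `τ = n^(2/3) / k^(1/3)` with `k = OPT`. Each path chosen in stage one carries
a label of a fixed optimal solution, because otherwise the path would survive its removal. That
label has not been collected before, so there are at most `OPT` iterations
(`StageOne.le_ncard_inter`), each adding at most `τ` labels. After stage one the distance `d`
exceeds `τ`. The edges leaving a ball around `s` run between two consecutive distance layers, and a
simple graph has at most `a * b` of them when the layers have sizes `a` and `b`. By AM-GM a minimum
cut `F` satisfies `2√|F| ≤ a + b`; summing over the first `d` pairs of layers gives `d√|F| ≤ n`, so
`|F| ≤ n²/τ²` (`IsMinCut.ncard_mul_sq_le`). Since `τ³ * OPT = n²`, both stages contribute at most `τ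
* OPT`, hence the constant `2`. The guess `OPT` is among those tried, as `1 ≤ OPT ≤ q`.

Polynomial time. The program uses only loops over `0, …, n - 1` or `0, …, q - 1`. It then has a
total semantics `Prog.run`, a loop-invariant rule `Prog.rep_induction`, and a polynomial time bound
by structural induction. Each while loop of the algorithm becomes a fixed number of guarded rounds:
`q` suffice for stage one by the iteration bound, and `n` for the augmentations of stage two because
the out-degree of `s` bounds the flow. The threshold is tested exactly in integers, as `m³ * k ≤
n²`.

Minimum cuts come from augmenting paths, but no flow is stored. The invariant `IsResidual` says that
every `s`-`t` cut has lost the same amount of capacity; when `t` becomes unreachable, the reached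
set has residual capacity zero and is therefore a minimum cut (`IsAdj.isMinCut`). -/

/-! ## Bounded-loop programs

Every loop of such a program runs over `0, …, b - 1`, where `b` is the content of register `0` or
`1`. Their meaning is a total function, and they run in polynomial time. -/

namespace Ram

/-- Programs with bounded loops; `rep x b c` runs `c` for `x = 0, …, b - 1`, where `b` is the
content of register `b`. -/
inductive Prog : Type
  | skip
  | set (x : ℕ) (e : Expr)
  | put (a : ℕ) (i j e : Expr)
  | seq (c d : Prog)
  | ite (e : Expr) (c d : Prog)
  | rep (x b : ℕ) (c : Prog)

namespace Prog

def compile : Prog → Cmd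
  | skip => .skip
  | set x e => .set x e
  | put a i j e => .put a i j e
  | seq c d => .seq c.compile d.compile
  | ite e c d => .ite e c.compile d.compile
  | rep x b c => .seq (.set x (.lit 0))
      (.loop (.sub (.var b) (.var x)) (.seq c.compile (.set x (.add (.var x) (.lit 1)))))

/-- The iterates of a loop body `f` with loop register `x`. -/
def iter (f : Store → Store) (x : ℕ) (σ : Store) : ℕ → Store
  | 0 => σ
  | i + 1 => f ((iter f x σ i).setVar x i)

def run : Prog → Store → Store
  | skip, σ => σ
  | set x e, σ => σ.setVar x (e.eval σ)
  | put a i j e, σ => σ.putMem a (i.eval σ) (j.eval σ) (e.eval σ)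
  | seq c d, σ => d.run (c.run σ)
  | ite e c d, σ => if e.eval σ ≠ 0 then c.run σ else d.run σ
  | rep x b c, σ => (iter c.run x σ (σ.var b)).setVar x (σ.var b)

theorem run_seq (c d : Prog) (σ : Store) : (seq c d).run σ = d.run (c.run σ) := rfl

theorem run_ite_of_ne {e : Expr} (c d : Prog) {σ : Store} (h : e.eval σ ≠ 0) :
    (ite e c d).run σ = c.run σ := if_pos h

theorem run_ite_of_eq {e : Expr} (c d : Prog) {σ : Store} (h : e.eval σ = 0) :
    (ite e c d).run σ = d.run σ := if_neg (not_not.2 h)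

/-- The registers that a program may change. -/
def writes : Prog → List ℕ
  | skip => []
  | set x _ => [x]
  | put _ _ _ _ => []
  | seq c d => c.writes ++ d.writes
  | ite _ c d => c.writes ++ d.writes
  | rep x _ c => x :: c.writes

/-- The arrays that a program may change. -/
def arrays : Prog → List ℕ
  | skip => []
  | set _ _ => []
  | put a _ _ _ => [a]
  | seq c d => c.arrays ++ d.arrays
  | ite _ c d => c.arrays ++ d.arrays
  | rep _ _ c => c.arrays

/-- All loops are bounded by register `0` or `1`, and no body changes its loop register. -/
def Bounded : Prog → Prop
  | skip => True
  | set _ _ => True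
  | put _ _ _ _ => True
  | seq c d => c.Bounded ∧ d.Bounded
  | ite _ c d => c.Bounded ∧ d.Bounded
  | rep x b c => c.Bounded ∧ b ≤ 1 ∧ b ≠ x ∧ b ∉ c.writes ∧ x ∉ c.writes

instance decidableBounded : (p : Prog) → Decidable p.Bounded
  | skip => isTrue trivial
  | set _ _ => isTrue trivial
  | put _ _ _ _ => isTrue trivial
  | seq c d => @instDecidableAnd _ _ (decidableBounded c) (decidableBounded d)
  | ite _ c d => @instDecidableAnd _ _ (decidableBounded c) (decidableBounded d)
  | rep x b c => @instDecidableAnd _ _ (decidableBounded c)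
      (inferInstanceAs (Decidable (b ≤ 1 ∧ b ≠ x ∧ b ∉ c.writes ∧ x ∉ c.writes)))

/-- A bound on the running time when the registers `0` and `1` are at most `N`. -/
def time (N : ℕ) : Prog → ℕ
  | skip => 1
  | set _ e => e.cost + 1
  | put _ i j e => i.cost + j.cost + e.cost + 1
  | seq c d => c.time N + d.time N
  | ite e c d => e.cost + (c.time N + d.time N) + 1
  | rep _ _ c => N * (c.time N + 8) + 6

/-- `ρ` agrees with `σ` on everything that `p` cannot change. -/
def Agree (p : Prog) (σ ρ : Store) : Prop :=
  (∀ x, x ∉ p.writes → ρ.var x = σ.var x) ∧ ∀ a, a ∉ p.arrays → ρ.mem a = σ.mem a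

theorem agree_iter {c : Prog} (hc : ∀ σ, c.Agree σ (c.run σ)) (x b : ℕ) (σ : Store) (i : ℕ) :
    (rep x b c).Agree σ (iter c.run x σ i) := by
  induction i with
  | zero => exact ⟨fun _ _ => rfl, fun _ _ => rfl⟩
  | succ i ih =>
    refine ⟨fun y hy => ?_, fun a ha => ?_⟩
    · have hy' : y ≠ x ∧ y ∉ c.writes := by simpa [writes] using hy
      rw [iter, (hc _).1 y hy'.2, ← ih.1 y hy]
      simp [Store.setVar, hy'.1]
    · rw [iter, (hc _).2 a ha, ← ih.2 a ha]
      rfl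

/-- The frame rule. For concrete programs its side conditions are membership in explicit lists, so
`decide` settles them. -/
theorem agree_run (p : Prog) : ∀ σ, p.Agree σ (p.run σ) := by
  induction p with
  | skip => exact fun σ => ⟨fun _ _ => rfl, fun _ _ => rfl⟩
  | set x e =>
    refine fun σ => ⟨fun y hy => ?_, fun _ _ => rfl⟩
    have hy' : y ≠ x := by simpa [writes] using hy
    simp [run, Store.setVar, hy']
  | put a i j e =>
    refine fun σ => ⟨fun _ _ => rfl, fun b hb => ?_⟩
    have hb' : b ≠ a := by simpa [arrays] using hb
    simp [run, Store.putMem, hb']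
  | seq c d hc hd =>
    refine fun σ => ⟨fun y hy => ?_, fun a ha => ?_⟩
    · have hy' : y ∉ c.writes ∧ y ∉ d.writes := by simpa [writes] using hy
      rw [run, (hd _).1 y hy'.2, (hc _).1 y hy'.1]
    · have ha' : a ∉ c.arrays ∧ a ∉ d.arrays := by simpa [arrays] using ha
      rw [run, (hd _).2 a ha'.2, (hc _).2 a ha'.1]
  | ite e c d hc hd =>
    refine fun σ => ⟨fun y hy => ?_, fun a ha => ?_⟩
    · have hy' : y ∉ c.writes ∧ y ∉ d.writes := by simpa [writes] using hy
      rw [run]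
      split_ifs
      exacts [(hc _).1 y hy'.1, (hd _).1 y hy'.2]
    · have ha' : a ∉ c.arrays ∧ a ∉ d.arrays := by simpa [arrays] using ha
      rw [run]
      split_ifs
      exacts [(hc _).2 a ha'.1, (hd _).2 a ha'.2]
  | rep x b c hc =>
    refine fun σ => ⟨fun y hy => ?_, fun a ha => ?_⟩
    · have hy' : y ≠ x ∧ y ∉ c.writes := by simpa [writes] using hy
      rw [← (agree_iter hc x b σ (σ.var b)).1 y hy]
      simp [run, Store.setVar, hy'.1]
    · exact (agree_iter hc x b σ (σ.var b)).2 a ha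

/-- The invariant rule for loops. -/
theorem rep_induction {x b : ℕ} {c : Prog} {σ : Store} (Inv : ℕ → Store → Prop) {Q : Store → Prop}
    (start : Inv 0 σ)
    (step : ∀ i < σ.var b, ∀ ρ, (rep x b c).Agree σ ρ → Inv i ρ →
      Inv (i + 1) (c.run (ρ.setVar x i)))
    (done : ∀ ρ, (rep x b c).Agree σ ρ → Inv (σ.var b) ρ → Q (ρ.setVar x (σ.var b))) :
    Q ((rep x b c).run σ) := by
  have key : ∀ i ≤ σ.var b, Inv i (iter c.run x σ i) := by
    intro i
    induction i with
    | zero => exact fun _ => start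
    | succ i ih =>
      exact fun hi => step i hi _ (agree_iter c.agree_run x b σ i) (ih (Nat.le_of_succ_le hi))
  exact done _ (agree_iter c.agree_run x b σ _) (key _ le_rfl)

/-- Induction on the number `m` of rounds left, which is the value of the loop test because the body
changes neither `b` nor `x`. A round costs `8` beyond the body: `3` for the test, `1` for the loop
and `4` for the increment. -/
theorem exec_loop {c : Prog} {x b K : ℕ} (hbx : b ≠ x) (hb : b ∉ c.writes) (hx : x ∉ c.writes)
    {σ : Store} (hc : ∀ ρ, (rep x b c).Agree σ ρ → ∀ i,
      ∃ T ≤ K, Exec c.compile (ρ.setVar x i) T (c.run (ρ.setVar x i)))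
    (m i : ℕ) (him : i + m = σ.var b) :
    ∃ T ≤ m * (K + 8) + 4,
      Exec (.loop (.sub (.var b) (.var x)) (.seq c.compile (.set x (.add (.var x) (.lit 1)))))
        ((iter c.run x σ i).setVar x i) T ((iter c.run x σ (σ.var b)).setVar x (σ.var b)) := by
  have hvb : ∀ i, ((iter c.run x σ i).setVar x i).var b = σ.var b := fun i => by
    rw [← (agree_iter c.agree_run x b σ i).1 b (by simp [writes, hbx, hb])]
    simp [Store.setVar, hbx]
  have hvx : ∀ i, ((iter c.run x σ i).setVar x i).var x = i := fun i => by simp [Store.setVar]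
  induction m generalizing i with
  | zero =>
    obtain rfl : i = σ.var b := by omega
    refine ⟨_, ?_, Exec.loopStop ?_⟩
    · simp [Expr.cost]
    · simp [Expr.eval, hvb, hvx]
  | succ m ih =>
    obtain ⟨T, hT, hexec⟩ := hc _ (agree_iter c.agree_run x b σ i) i
    obtain ⟨U, hU, hloop⟩ := ih (i + 1) (by omega)
    have hset : (c.run ((iter c.run x σ i).setVar x i)).setVar x
        ((Expr.add (.var x) (.lit 1)).eval (c.run ((iter c.run x σ i).setVar x i))) =
        (iter c.run x σ (i + 1)).setVar x (i + 1) := by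
      simp only [Expr.eval, iter]
      rw [(c.agree_run _).1 x hx, hvx]
    have hbody := Exec.seq hexec (Exec.set _ x (.add (.var x) (.lit 1)))
    rw [hset] at hbody
    refine ⟨_, ?_, Exec.loopStep ?_ hbody hloop⟩
    · simp only [Expr.cost]
      nlinarith
    · simp only [Expr.eval, hvb, hvx]
      omega

theorem exec_compile (N : ℕ) (p : Prog) (hp : p.Bounded) (h0 : 0 ∉ p.writes) (h1 : 1 ∉ p.writes)
    (σ : Store) (hσ0 : σ.var 0 ≤ N) (hσ1 : σ.var 1 ≤ N) :
    ∃ T ≤ p.time N, Exec p.compile σ T (p.run σ) := by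
  induction p generalizing σ with
  | skip => exact ⟨_, le_rfl, .skip σ⟩
  | set x e => exact ⟨_, le_rfl, .set σ x e⟩
  | put a i j e => exact ⟨_, le_rfl, .put σ a i j e⟩
  | seq c d hc hd =>
    simp only [writes, List.mem_append, not_or] at h0 h1
    obtain ⟨T, hT, hcT⟩ := hc hp.1 h0.1 h1.1 σ hσ0 hσ1
    obtain ⟨U, hU, hdU⟩ := hd hp.2 h0.2 h1.2 (c.run σ)
      (by rwa [(c.agree_run σ).1 0 h0.1]) (by rwa [(c.agree_run σ).1 1 h1.1])
    exact ⟨_, Nat.add_le_add hT hU, .seq hcT hdU⟩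
  | ite e c d hc hd =>
    simp only [writes, List.mem_append, not_or] at h0 h1
    by_cases he : e.eval σ = 0
    · obtain ⟨T, hT, h⟩ := hd hp.2 h0.2 h1.2 σ hσ0 hσ1
      refine ⟨_, ?_, by simpa [run, compile, he] using Exec.iteFalse he h⟩
      simp only [time]
      omega
    · obtain ⟨T, hT, h⟩ := hc hp.1 h0.1 h1.1 σ hσ0 hσ1
      refine ⟨_, ?_, by simpa [run, compile, he] using Exec.iteTrue he h⟩
      simp only [time]
      omega
  | rep x b c hc =>
    obtain ⟨hcb, hb1, hbx, hb, hx⟩ := hp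
    simp only [writes, List.mem_cons, not_or] at h0 h1
    have hσb : σ.var b ≤ N := by
      interval_cases b <;> assumption
    obtain ⟨T, hT, h⟩ := exec_loop (K := c.time N) (σ := σ) hbx hb hx
      (fun ρ hρ i => hc hcb h0.2 h1.2 _
        (by simpa [Store.setVar, h0.1, hρ.1 0 (by simp [writes, h0])] using hσ0)
        (by simpa [Store.setVar, h1.1, hρ.1 1 (by simp [writes, h1])] using hσ1))
      (σ.var b) 0 (by omega)
    refine ⟨_, ?_, .seq (.set σ x (.lit 0)) h⟩
    have := Nat.mul_le_mul_right (c.time N + 8) hσb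
    simp only [time, Expr.cost]
    omega

/-- Programs with bounded loops run in polynomial time. -/
theorem exists_time_le (p : Prog) : ∃ c d : ℕ, ∀ N, p.time N ≤ c * (N + 1) ^ d := by
  -- `time` is built from constants by sums and multiplication by `N`, and bounds `c * (N + 1) ^ d`
  -- are closed under both. The base is `N + 1 ≥ 1`, so raising the exponent never lowers the bound.
  have const : ∀ k : ℕ, ∃ c d : ℕ, ∀ N : ℕ, k ≤ c * (N + 1) ^ d := fun k => ⟨k, 0, by simp⟩
  have add : ∀ f g : ℕ → ℕ, (∃ c d : ℕ, ∀ N, f N ≤ c * (N + 1) ^ d) →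
      (∃ c d : ℕ, ∀ N, g N ≤ c * (N + 1) ^ d) →
      ∃ c d : ℕ, ∀ N, f N + g N ≤ c * (N + 1) ^ d := by
    rintro f g ⟨c, d, h⟩ ⟨c', d', h'⟩
    refine ⟨c + c', d + d', fun N => (Nat.add_le_add (h N) (h' N)).trans ?_⟩
    rw [add_mul]
    gcongr <;> omega
  have mul : ∀ f : ℕ → ℕ, (∃ c d : ℕ, ∀ N, f N ≤ c * (N + 1) ^ d) →
      ∃ c d : ℕ, ∀ N, N * f N ≤ c * (N + 1) ^ d := by
    rintro f ⟨c, d, h⟩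
    refine ⟨c, d + 1, fun N => (Nat.mul_le_mul (Nat.le_succ N) (h N)).trans (le_of_eq ?_)⟩
    rw [Nat.succ_eq_add_one]
    ring
  induction p with
  | skip => exact const _
  | set x e => exact const _
  | put a i j e => exact const _
  | seq c d hc hd => exact add _ _ hc hd
  | ite e c d hc hd => exact add _ _ (add _ _ (const _) (add _ _ hc hd)) (const _)
  | rep x b c hc => exact add _ _ (mul _ (add _ _ hc (const _))) (const _)

end Prog

end Ram

/-! ## The approximation guarantee -/

namespace LabelCut

namespace Network

variable {n : ℕ} {N : Network n}

/-- Simplicity of the graph enters here: it lets edges be counted by pairs of ends. -/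
theorem Joins.edge_unique {e f : N.Edge} {u v : Fin n} (he : N.Joins e u v)
    (hf : N.Joins f u v) : e = f := by
  cases N <;> exact Subtype.ext (Eq.trans he (Eq.symm hf))

theorem Joins.ends_unique {e : N.Edge} {u v u' v' : Fin n} (h : N.Joins e u v)
    (h' : N.Joins e u' v') : u = u' ∧ v = v' ∨ u = v' ∧ v = u' := by
  cases N with
  | undirected G => exact Sym2.eq_iff.1 (Eq.trans (Eq.symm h) h')
  | directed D hD => exact Or.inl (Prod.ext_iff.1 (Eq.trans (Eq.symm h) h'))

instance finite_edge : Finite N.Edge := by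
  cases N with
  | undirected G => exact inferInstanceAs (Finite G.edgeSet)
  | directed D hD => exact inferInstanceAs (Finite {p : Fin n × Fin n // D.Adj p.1 p.2})

end Network

namespace Instance

variable {I : Instance}

theorem Walk.mem {S : Set I.Edge} {u v : Fin I.n} {P : List I.Edge} (h : I.Walk S u v P) :
    ∀ e ∈ P, e ∈ S := by
  induction h with
  | nil => simp
  | cons he _ _ ih => simpa using ⟨he, ih⟩

theorem Walk.of_mem {S S' : Set I.Edge} {u v : Fin I.n} {P : List I.Edge} (h : I.Walk S u v P)
    (hP : ∀ e ∈ P, e ∈ S') : I.Walk S' u v P := by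
  induction h with
  | nil => exact .nil _
  | cons he hj _ ih =>
    simp only [List.mem_cons, forall_eq_or_imp] at hP
    exact .cons hP.1 hj (ih hP.2)

theorem Walk.append {S : Set I.Edge} {u v w : Fin I.n} {P Q : List I.Edge} (h : I.Walk S u v P)
    (h' : I.Walk S v w Q) : I.Walk S u w (P ++ Q) := by
  induction h with
  | nil => exact h'
  | cons he hj _ ih => exact .cons he hj (ih h')

theorem Walk.concat {S : Set I.Edge} {u v w : Fin I.n} {P : List I.Edge} {e : I.Edge}
    (h : I.Walk S u v P) (he : e ∈ S) (hj : I.graph.Joins e v w) : I.Walk S u w (P ++ [e]) :=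
  h.append (.cons he hj (.nil _))

theorem disconnected_empty : I.Disconnected (∅ : Set I.Edge) := by
  intro P h
  generalize hS : (∅ : Set I.Edge) = S at h
  generalize hs : I.s = u at h
  generalize ht : I.t = v at h
  cases h with
  | nil => exact I.s_ne_t (hs.trans ht.symm)
  | cons he => rw [← hS] at he; exact he

theorem Disconnected.mono {S S' : Set I.Edge} (h : I.Disconnected S') (hS : S ⊆ S') :
    I.Disconnected S :=
  fun P hP => h P (hP.of_mem fun e he => hS (hP.mem e he))

theorem isLabelCut_univ : I.IsLabelCut Set.univ :=
  disconnected_empty.mono fun _ he => he (Set.mem_univ _)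

/-- The set of all labels is feasible, so the default `sInf ∅ = 0` plays no role in `opt`. -/
theorem exists_opt : ∃ X : Set (Fin I.q), I.IsLabelCut X ∧ X.ncard = I.opt :=
  Nat.sInf_mem (s := {c | ∃ X : Set (Fin I.q), I.IsLabelCut X ∧ X.ncard = c})
    ⟨_, _, isLabelCut_univ, rfl⟩

theorem ncard_label_le (X : Set (Fin I.q)) : X.ncard ≤ I.q := by
  simpa using Set.ncard_le_card X

theorem opt_le : I.opt ≤ I.q := by
  obtain ⟨X, _, hX⟩ := I.exists_opt
  exact hX ▸ ncard_label_le X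

theorem ncard_labels_list_le (P : List I.Edge) : (I.labels {f | f ∈ P}).ncard ≤ P.length := by
  classical
  refine (Set.ncard_image_le (Set.toFinite _)).trans ?_
  rw [← List.coe_toFinset, Set.ncard_coe_finset]
  exact P.toFinset_card_le

/-! ### Stage one -/

theorem StageOne.eq_compl {k h : ℕ} {S : Set I.Edge} {A : Set (Fin I.q)}
    (H : I.StageOne k h S A) : S = {e | I.label e ∉ A} := by
  induction H with
  | start => simp
  | step _ _ _ ih => ext e; simp [ih]

/-- The chosen path meets `X`, and it does so in a label outside `A`, as the edges with labels in
`A` are gone. Hence `A ∩ X` grows strictly in each iteration. An optimal `X` bounds the iterations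
by `OPT`, and `X = Set.univ` bounds them by `q` for every guess. -/
theorem StageOne.le_ncard_inter {k h : ℕ} {S : Set I.Edge} {A X : Set (Fin I.q)}
    (H : I.StageOne k h S A) (hX : I.IsLabelCut X) : h ≤ (A ∩ X).ncard := by
  induction H with
  | start => exact Nat.zero_le _
  | @step h S A P H hP _ ih =>
    obtain ⟨e, heP, heX⟩ : ∃ e ∈ P, I.label e ∈ X := by
      by_contra! hc
      exact hX P (hP.1.of_mem hc)
    have heA : I.label e ∉ A := by
      have := hP.1.mem e heP
      rwa [H.eq_compl] at this
    refine Nat.succ_le_of_lt (ih.trans_lt (Set.ncard_lt_ncard ?_ (Set.toFinite _)))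
    refine ⟨Set.inter_subset_inter_left _ Set.subset_union_left, fun hsub => heA ?_⟩
    exact (hsub ⟨Or.inr ⟨e, heP, rfl⟩, heX⟩).1

theorem StageOne.le_q {k h : ℕ} {S : Set I.Edge} {A : Set (Fin I.q)}
    (H : I.StageOne k h S A) : h ≤ I.q :=
  (H.le_ncard_inter isLabelCut_univ).trans (ncard_label_le _)

theorem StageOne.ncard_le {k h : ℕ} {S : Set I.Edge} {A : Set (Fin I.q)}
    (H : I.StageOne k h S A) : (A.ncard : ℝ) ≤ h * I.threshold k := by
  induction H with
  | start => simp
  | @step h S A P H _ hP ih =>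
    have h1 : ((A ∪ I.labels {f | f ∈ P}).ncard : ℝ) ≤ A.ncard + P.length := by
      exact_mod_cast (Set.ncard_union_le _ _).trans
        (Nat.add_le_add_left (ncard_labels_list_le P) _)
    push_cast
    linarith

/-! ### Edge cuts -/

/-- The edges in `S` that leave the vertex set `U`. -/
def crossing (S : Set I.Edge) (U : Set (Fin I.n)) : Set I.Edge :=
  {e | e ∈ S ∧ ∃ u v, I.graph.Joins e u v ∧ u ∈ U ∧ v ∉ U}

/-- The pairs of ends of the edges in `S` that leave the vertex set `U`. -/
def crossingPairs (S : Set I.Edge) (U : Set (Fin I.n)) : Set (Fin I.n × Fin I.n) :=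
  {p | p.1 ∈ U ∧ p.2 ∉ U ∧ ∃ e ∈ S, I.graph.Joins e p.1 p.2}

/-- A pair of ends determines the edge, and a crossing edge has only one pair of ends leaving `U`:
the reversed pair of an undirected edge enters `U`. -/
theorem ncard_crossing (S : Set I.Edge) (U : Set (Fin I.n)) :
    (crossing S U).ncard = (crossingPairs S U).ncard := by
  have : Nonempty (Fin I.n × Fin I.n) := ⟨(I.s, I.t)⟩
  have hex : ∀ e ∈ crossing S U, ∃ p : Fin I.n × Fin I.n,
      I.graph.Joins e p.1 p.2 ∧ p.1 ∈ U ∧ p.2 ∉ U := by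
    rintro e ⟨_, u, v, h⟩
    exact ⟨(u, v), h⟩
  choose! g hg using hex
  have hinj : Set.InjOn g (crossing S U) := fun e he f hf hef =>
    (hg e he).1.edge_unique (hef ▸ (hg f hf).1)
  rw [← hinj.ncard_image]
  congr 1
  ext p
  constructor
  · rintro ⟨e, he, rfl⟩
    exact ⟨(hg e he).2.1, (hg e he).2.2, e, he.1, (hg e he).1⟩
  · rintro ⟨h1, h2, e, heS, hj⟩
    have he : e ∈ crossing S U := ⟨heS, _, _, hj, h1, h2⟩
    obtain ⟨hj', h1', h2'⟩ := hg e he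
    refine ⟨e, he, ?_⟩
    rcases hj'.ends_unique hj with ⟨h, h'⟩ | ⟨h, h'⟩
    · exact Prod.ext h h'
    · exact absurd (h ▸ h1') h2

theorem Walk.mem_of_crossing_free {S : Set I.Edge} {U : Set (Fin I.n)} {u v : Fin I.n}
    {P : List I.Edge} (h : I.Walk (S \ crossing S U) u v P) (hu : u ∈ U) : v ∈ U := by
  induction h with
  | nil => exact hu
  | cons he hj _ ih =>
    refine ih ?_
    by_contra hv
    exact he.2 ⟨he.1, _, _, hj, hu, hv⟩

theorem disconnected_diff_crossing (S : Set I.Edge) {U : Set (Fin I.n)} (hs : I.s ∈ U)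
    (ht : I.t ∉ U) : I.Disconnected (S \ crossing S U) :=
  fun _ hP => ht (hP.mem_of_crossing_free hs)

/-- The witness is the set of vertices reachable from `s` without `F`. -/
theorem Disconnected.exists_crossing_subset {S F : Set I.Edge} (h : I.Disconnected (S \ F)) :
    ∃ U : Set (Fin I.n), I.s ∈ U ∧ I.t ∉ U ∧ crossing S U ⊆ F := by
  refine ⟨{v | ∃ P, I.Walk (S \ F) I.s v P}, ⟨[], .nil _⟩, fun ⟨P, hP⟩ => h P hP, ?_⟩
  rintro e ⟨heS, u, v, hj, ⟨P, hP⟩, hv⟩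
  by_contra heF
  exact hv ⟨_, hP.concat ⟨heS, heF⟩ hj⟩

theorem crossing_subset (S : Set I.Edge) (U : Set (Fin I.n)) : crossing S U ⊆ S :=
  fun _ he => he.1

theorem IsMinCut.ncard_le {S F : Set I.Edge} (h : I.IsMinCut S F) {U : Set (Fin I.n)}
    (hs : I.s ∈ U) (ht : I.t ∉ U) : F.ncard ≤ (crossingPairs S U).ncard :=
  ncard_crossing S U ▸ h.2.2 _ (crossing_subset S U) (disconnected_diff_crossing S hs ht)

theorem IsMinCut.eq_empty {S F : Set I.Edge} (h : I.IsMinCut S F) (hS : I.Disconnected S) :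
    F = ∅ := by
  have := h.2.2 ∅ (Set.empty_subset _) (by simpa using hS)
  rw [Set.ncard_empty, Nat.le_zero] at this
  exact (Set.ncard_eq_zero (Set.toFinite F)).1 this

/-! ### Distance layers and the size of a minimum cut -/

/-- The vertices at distance less than `i` from `s`. -/
def near (S : Set I.Edge) (i : ℕ) : Set (Fin I.n) :=
  {v | ∃ P, I.Walk S I.s v P ∧ P.length < i}

theorem near_mono (S : Set I.Edge) (i : ℕ) : near S i ⊆ near S (i + 1) :=
  fun _ ⟨P, hP, hi⟩ => ⟨P, hP, Nat.lt_succ_of_lt hi⟩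

/-- The vertices at distance `i` from `s`. -/
def layer (S : Set I.Edge) (i : ℕ) : Set (Fin I.n) := near S (i + 1) \ near S i

/-- The strict inequality in `near` makes `near S 0` empty, so the sum telescopes to the size of
`near S m`. -/
theorem sum_ncard_layer_le (S : Set I.Edge) (m : ℕ) :
    ∑ i ∈ Finset.range m, (layer S i).ncard ≤ I.n := by
  have key : ∑ i ∈ Finset.range m, (layer S i).ncard = (near S m).ncard := by
    induction m with
    | zero => simp [near]
    | succ m ih =>
      rw [Finset.sum_range_succ, ih, add_comm]
      exact Set.ncard_sdiff_add_ncard_of_subset (near_mono S m)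
  rw [key]
  simpa using Set.ncard_le_card (near S m)

theorem crossingPairs_near_subset (S : Set I.Edge) (i : ℕ) :
    crossingPairs S (near S (i + 1)) ⊆ layer S i ×ˢ layer S (i + 1) := by
  rintro ⟨u, v⟩ ⟨hu, hv, e, he, hj⟩
  have key : ∀ m, u ∈ near S m → v ∈ near S (m + 1) := by
    rintro m ⟨P, hP, hm⟩
    exact ⟨_, hP.concat he hj, by simpa using hm⟩
  exact ⟨⟨hu, fun h => hv (key i h)⟩, key _ hu, hv⟩

/-- If the `s`-`t` distance is larger than `τ`, then a minimum cut has at most `n² / τ²` edges. -/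
theorem IsMinCut.ncard_mul_sq_le {S F : Set I.Edge} (h : I.IsMinCut S F) {τ : ℝ} (hτ : 0 ≤ τ)
    (hdist : ∀ P, I.Walk S I.s I.t P → τ < (P.length : ℝ)) :
    (F.ncard : ℝ) * τ ^ 2 ≤ (I.n : ℝ) ^ 2 := by
  by_cases hS : I.Disconnected S
  · rw [h.eq_empty hS]
    simp
  obtain ⟨P₀, hP₀⟩ : ∃ P, I.Walk S I.s I.t P := by
    simpa [Disconnected] using hS
  obtain ⟨d, ⟨P, hP, rfl⟩, hmin⟩ : ∃ d, (∃ P, I.Walk S I.s I.t P ∧ P.length = d) ∧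
      ∀ Q, I.Walk S I.s I.t Q → d ≤ Q.length := by
    classical
    have hex : ∃ d, ∃ P, I.Walk S I.s I.t P ∧ P.length = d := ⟨_, P₀, hP₀, rfl⟩
    exact ⟨Nat.find hex, Nat.find_spec hex, fun Q hQ => Nat.find_min' hex ⟨Q, hQ, rfl⟩⟩
  -- For `i` below the distance, `near S (i + 1)` separates `s` from `t`, so `F` is at most the
  -- product of two consecutive layer sizes; then AM-GM.
  have hstep : ∀ i ∈ Finset.range P.length,
      2 * √(F.ncard : ℝ) ≤ ((layer S i).ncard : ℝ) + (layer S (i + 1)).ncard := by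
    intro i hi
    have h1 : F.ncard ≤ (layer S i).ncard * (layer S (i + 1)).ncard := by
      rw [← Set.ncard_prod]
      refine (h.ncard_le (U := near S (i + 1)) ⟨[], .nil _, Nat.succ_pos i⟩ ?_).trans
        (Set.ncard_le_ncard (crossingPairs_near_subset S i) (Set.toFinite _))
      rintro ⟨Q, hQ, hQi⟩
      have := hmin Q hQ
      have := Finset.mem_range.1 hi
      omega
    have h2 : (F.ncard : ℝ) ≤ (layer S i).ncard * (layer S (i + 1)).ncard := by exact_mod_cast h1
    have h3 : √(F.ncard : ℝ) ≤ (((layer S i).ncard : ℝ) + (layer S (i + 1)).ncard) / 2 := by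
      refine Real.sqrt_le_iff.2 ⟨by positivity, ?_⟩
      nlinarith [sq_nonneg (((layer S i).ncard : ℝ) - (layer S (i + 1)).ncard)]
    linarith
  have hsum := Finset.sum_le_sum hstep
  rw [Finset.sum_const, Finset.card_range, nsmul_eq_mul, Finset.sum_add_distrib] at hsum
  have h1 : (∑ i ∈ Finset.range P.length, ((layer S i).ncard : ℝ)) ≤ I.n := by
    exact_mod_cast sum_ncard_layer_le S P.length
  have h2 : (∑ i ∈ Finset.range P.length, ((layer S (i + 1)).ncard : ℝ)) ≤ I.n := by
    have := sum_ncard_layer_le S (P.length + 1)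
    rw [Finset.sum_range_succ'] at this
    exact_mod_cast (Nat.le_add_right _ _).trans this
  -- The sum over `i` reads `P.length * (2 * √|F|) ≤ 2 * n`, and `τ < P.length`.
  have h3 : √(F.ncard : ℝ) * τ ≤ I.n := by
    nlinarith [hdist P hP, Real.sqrt_nonneg (F.ncard : ℝ)]
  calc (F.ncard : ℝ) * τ ^ 2 = (√(F.ncard : ℝ) * τ) ^ 2 := by
        rw [mul_pow, Real.sq_sqrt (Nat.cast_nonneg _)]
    _ ≤ (I.n : ℝ) ^ 2 := pow_le_pow_left₀ (by positivity) h3 2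

/-! ### The guarantee -/

theorem n_pos (I : Instance) : 0 < I.n := I.s.pos

theorem threshold_pos {k : ℕ} (hk : 0 < k) : 0 < I.threshold k := by
  have := I.n_pos
  unfold threshold
  positivity

/-- The identity that balances the stages: it turns the cut bound `n² / τ²` into `τ * k`, the bound
for stage one. -/
theorem threshold_pow_mul {k : ℕ} (hk : 0 < k) :
    I.threshold k ^ 3 * (k : ℝ) = (I.n : ℝ) ^ 2 := by
  have hk' : (0 : ℝ) < k := by exact_mod_cast hk
  have h1 : ((I.n : ℝ) ^ (2 / 3 : ℝ)) ^ 3 = (I.n : ℝ) ^ 2 := by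
    rw [← Real.rpow_natCast, ← Real.rpow_mul (Nat.cast_nonneg _), ← Real.rpow_natCast]
    norm_num
  have h2 : ((k : ℝ) ^ (1 / 3 : ℝ)) ^ 3 = k := by
    rw [← Real.rpow_natCast, ← Real.rpow_mul (Nat.cast_nonneg _)]
    norm_num
  rw [threshold, div_pow, h1, h2]
  field_simp

theorem le_threshold_iff {k : ℕ} (hk : 0 < k) (m : ℕ) :
    (m : ℝ) ≤ I.threshold k ↔ m ^ 3 * k ≤ I.n ^ 2 := by
  have hk' : (0 : ℝ) < k := by exact_mod_cast hk
  rw [← pow_le_pow_iff_left₀ (Nat.cast_nonneg m) (threshold_pos hk).le three_ne_zero,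
    ← mul_le_mul_iff_left₀ hk', threshold_pow_mul hk]
  exact_mod_cast Iff.rfl

theorem Run.isLabelCut {k : ℕ} {X : Set (Fin I.q)} (h : I.Run k X) : I.IsLabelCut X := by
  obtain ⟨_, S, A, F, hA, _, hF, rfl⟩ := h
  refine hF.2.1.mono fun e he => ⟨?_, fun heF => he (Or.inr ⟨e, heF, rfl⟩)⟩
  rw [hA.eq_compl]
  exact fun h => he (Or.inl h)

theorem Run.withinRatio {X : Set (Fin I.q)} (hpos : 0 < I.opt) (h : I.Run I.opt X) :
    I.WithinRatio 2 X := by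
  obtain ⟨m, S, A, F, hA, hdist, hF, rfl⟩ := h
  obtain ⟨Z, hZ, hZopt⟩ := I.exists_opt
  have hτ := threshold_pos (I := I) hpos
  have hk : (0 : ℝ) < I.opt := by exact_mod_cast hpos
  have hm : (m : ℝ) ≤ I.opt := by
    rw [← hZopt]
    exact_mod_cast (hA.le_ncard_inter hZ).trans
      (Set.ncard_le_ncard Set.inter_subset_right (Set.toFinite _))
  have h1 : (A.ncard : ℝ) ≤ I.threshold I.opt * I.opt := by
    nlinarith [hA.ncard_le]
  have h2 : (F.ncard : ℝ) ≤ I.threshold I.opt * I.opt := by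
    have h3 := hF.ncard_mul_sq_le hτ.le hdist
    rw [← threshold_pow_mul hpos] at h3
    refine le_of_mul_le_mul_right (h3.trans_eq ?_) (pow_pos hτ 2)
    ring
  have h3 : ((A ∪ I.labels F).ncard : ℝ) ≤ A.ncard + F.ncard := by
    exact_mod_cast (Set.ncard_union_le _ _).trans
      (Nat.add_le_add_left (Set.ncard_image_le (Set.toFinite F)) _)
  -- The ratio in `WithinRatio` is by definition the threshold for the guess `opt`.
  change _ ≤ 2 * I.threshold I.opt * _
  linarith

theorem Run.eq_empty {k : ℕ} {X : Set (Fin I.q)} (hopt : I.opt = 0) (h : I.Run k X) : X = ∅ := by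
  obtain ⟨m, S, A, F, hA, _, hF, rfl⟩ := h
  obtain ⟨Z, hZ, hZopt⟩ := I.exists_opt
  have hZ0 : Z = ∅ := (Set.ncard_eq_zero (Set.toFinite Z)).1 (hZopt.trans hopt)
  have hcon : I.Disconnected Set.univ := by
    simpa [IsLabelCut, hZ0] using hZ
  have hA0 : A = ∅ := by
    cases hA with
    | start => rfl
    | step _ hP => exact absurd (hP.1.of_mem fun _ _ => Set.mem_univ _) (hcon _)
  rw [hA0, hF.eq_empty (hcon.mono (Set.subset_univ _))]
  simp [labels]

theorem Returns.exists_run {X : Set (Fin I.q)} (h : I.Returns X) : ∃ k, I.Run k X := by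
  obtain ⟨Y, hY, k, hk, rfl, _⟩ := h
  exact ⟨k, hY k hk⟩

theorem Returns.withinRatio {X : Set (Fin I.q)} (hpos : 0 < I.opt) (h : I.Returns X) :
    I.WithinRatio 2 X := by
  obtain ⟨Y, hY, k, hk, rfl, hmin⟩ := h
  have hmem : I.opt ∈ Finset.Icc 1 I.q := Finset.mem_Icc.2 ⟨hpos, opt_le⟩
  exact (Nat.cast_le.2 (hmin _ hmem)).trans ((hY _ hmem).withinRatio hpos)

end Instance

end LabelCut

/-! ## Breadth first search and augmenting paths on matrices -/

namespace LabelCut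

/-- `D v - 1` is the length of a path from `s` to `v` along the predecessors `P`; `D v = 0` when
`v` has not been reached. -/
structure Layered (n s : ℕ) (R : ℕ → ℕ → ℕ) (D P : ℕ → ℕ) : Prop where
  root : D s = 1
  root_unique : ∀ v < n, D v = 1 → v = s
  pred : ∀ v < n, 2 ≤ D v → P v < n ∧ D (P v) + 1 = D v ∧ R (P v) v ≠ 0

/-- Following predecessors from `v` meets each of the values `1, …, D v`, and `n` vertices have at
most `n` values. This is why `n` rounds suffice for searching and for tracing a path. -/
theorem Layered.le {n s : ℕ} {R : ℕ → ℕ → ℕ} {D P : ℕ → ℕ} (h : Layered n s R D P) {v : ℕ}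
    (hv : v < n) : D v ≤ n := by
  have key : ∀ m v, v < n → D v = m → ∀ j < m, ∃ w < n, D w = j + 1 := by
    intro m
    induction m with
    | zero => simp
    | succ m ih =>
      intro v hv hm j hj
      rcases Nat.lt_succ_iff_lt_or_eq.1 hj with hj | rfl
      · obtain ⟨h1, h2, _⟩ := h.pred v hv (by omega)
        exact ih (P v) h1 (by omega) j hj
      · exact ⟨v, hv, hm⟩
  have hsub : (Finset.range (D v)).image (· + 1) ⊆ (Finset.range n).image D := by
    intro m hm
    obtain ⟨j, hj, rfl⟩ := Finset.mem_image.1 hm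
    obtain ⟨w, hw, hwj⟩ := key _ v hv rfl j (Finset.mem_range.1 hj)
    exact Finset.mem_image.2 ⟨w, Finset.mem_range.2 hw, hwj⟩
  have := (Finset.card_le_card hsub).trans Finset.card_image_le
  rwa [Finset.card_image_of_injective _ (add_left_injective 1), Finset.card_range,
    Finset.card_range] at this

/-- `D v - 1` is the distance from `s` to `v`. -/
structure IsBfs (n s : ℕ) (R : ℕ → ℕ → ℕ) (D P : ℕ → ℕ) : Prop extends Layered n s R D P where
  closed : ∀ u < n, ∀ v < n, D u ≠ 0 → R u v ≠ 0 → D v ≠ 0 ∧ D v ≤ D u + 1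

/-- The state of the search in round `i`, after the pairs before `(u, v)` have been scanned. -/
structure Scanned (n s : ℕ) (R : ℕ → ℕ → ℕ) (D P : ℕ → ℕ) (i u v : ℕ) : Prop
    extends Layered n s R D P where
  bound : ∀ w < n, D w ≤ i + 2
  closed : ∀ u' < n, ∀ v' < n, D u' ≠ 0 →
    (D u' ≤ i ∨ D u' = i + 1 ∧ (u' < u ∨ u' = u ∧ v' < v)) → R u' v' ≠ 0 →
      D v' ≠ 0 ∧ D v' ≤ D u' + 1

theorem Scanned.start {n s : ℕ} {R : ℕ → ℕ → ℕ} {D P : ℕ → ℕ}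
    (hD : ∀ v < n, D v = if v = s then 1 else 0) (hs : s < n) : Scanned n s R D P 0 0 0 where
  root := by simp [hD s hs]
  root_unique v hv h := by
    by_contra hne
    simp [hD v hv, hne] at h
  pred v hv h := by
    rw [hD v hv] at h
    split_ifs at h <;> omega
  bound v hv := by
    rw [hD v hv]
    split_ifs <;> omega
  closed u _ v _ := by omega

theorem Scanned.next_row {n s : ℕ} {R : ℕ → ℕ → ℕ} {D P : ℕ → ℕ} {i u : ℕ}
    (h : Scanned n s R D P i u n) : Scanned n s R D P i (u + 1) 0 where
  toLayered := h.toLayered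
  bound := h.bound
  closed u' hu' v' hv' h0 hD := h.closed u' hu' v' hv' h0 (by omega)

theorem Scanned.next_round {n s : ℕ} {R : ℕ → ℕ → ℕ} {D P : ℕ → ℕ} {i : ℕ}
    (h : Scanned n s R D P i n 0) : Scanned n s R D P (i + 1) 0 0 where
  toLayered := h.toLayered
  bound w hw := (h.bound w hw).trans (Nat.le_succ _)
  closed u' hu' v' hv' h0 hD := h.closed u' hu' v' hv' h0 (by omega)

/-- In round `n` the restriction `D u ≤ i` in the closure condition is void by `Layered.le`. -/
theorem Scanned.isBfs {n s : ℕ} {R : ℕ → ℕ → ℕ} {D P : ℕ → ℕ}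
    (h : Scanned n s R D P n 0 0) : IsBfs n s R D P where
  toLayered := h.toLayered
  closed u hu v hv h0 := h.closed u hu v hv h0 (Or.inl (h.toLayered.le hu))

theorem Scanned.skip {n s : ℕ} {R : ℕ → ℕ → ℕ} {D P : ℕ → ℕ} {i u v : ℕ}
    (h : Scanned n s R D P i u v) (hv : v < n) (hc : ¬ (D u = i + 1 ∧ R u v ≠ 0 ∧ D v = 0)) :
    Scanned n s R D P i u (v + 1) where
  toLayered := h.toLayered
  bound := h.bound
  closed u' hu' v' hv' h0 hD hR := by
    by_cases hnew : D u' = i + 1 ∧ u' = u ∧ v' = v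
    · obtain ⟨h1, rfl, rfl⟩ := hnew
      have := h.bound v' hv
      exact ⟨fun h2 => hc ⟨h1, hR, h2⟩, by omega⟩
    · exact h.closed u' hu' v' hv' h0 (by omega) hR

theorem Scanned.visit {n s : ℕ} {R : ℕ → ℕ → ℕ} {D P D' P' : ℕ → ℕ} {i u v : ℕ}
    (h : Scanned n s R D P i u v) (hu : u < n)
    (hc : D u = i + 1 ∧ R u v ≠ 0 ∧ D v = 0) (hD : ∀ w, D' w = if w = v then i + 2 else D w)
    (hP : ∀ w, P' w = if w = v then u else P w) : Scanned n s R D' P' i u (v + 1) := by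
  obtain ⟨hDu, hR, hDv⟩ := hc
  have hDv' : D' v = i + 2 := by simp [hD]
  have hD' : ∀ w, w ≠ v → D' w = D w := fun w hw => by simp [hD, hw]
  have hPv : P' v = u := by simp [hP]
  have hP' : ∀ w, w ≠ v → P' w = P w := fun w hw => by simp [hP, hw]
  have hne : ∀ w, D w ≠ 0 → w ≠ v := fun w h hw => h (hw ▸ hDv)
  refine ⟨⟨?_, ?_, ?_⟩, ?_, ?_⟩
  · rw [hD' s (hne s (by simp [h.root])), h.root]
  · intro w hw h1
    by_cases hwv : w = v
    · subst hwv
      omega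
    · exact h.root_unique w hw (hD' w hwv ▸ h1)
  · intro w hw h2
    by_cases hwv : w = v
    · subst hwv
      rw [hPv, hDv', hD' u (hne u (by omega)), hDu]
      exact ⟨hu, rfl, hR⟩
    · rw [hD' w hwv] at h2 ⊢
      obtain ⟨h3, h4, h5⟩ := h.pred w hw h2
      rw [hP' w hwv, hD' _ (hne _ (by omega))]
      exact ⟨h3, h4, h5⟩
  · intro w hw
    by_cases hwv : w = v
    · subst hwv
      omega
    · rw [hD' w hwv]
      exact h.bound w hw
  · intro u' hu' v' hv' h0 hlow hR'
    have huv : u' ≠ v := by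
      rintro rfl
      omega
    rw [hD' u' huv] at h0 hlow ⊢
    by_cases hvv : v' = v
    · subst hvv
      rw [hDv']
      refine ⟨by omega, ?_⟩
      -- A neighbour `u'` with `D u' ≤ i` was fully scanned earlier and would already have reached
      -- the new vertex.
      by_contra hcon
      exact (h.closed u' hu' v' hv' h0 (by omega) hR').1 hDv
    · rw [hD' v' hvv]
      exact h.closed u' hu' v' hv' h0 (by omega) hR'

/-! ### Residual capacities and optimality of the final cut -/

section Flow

open Classical in
/-- The total capacity of the arcs leaving `U`. -/
noncomputable def capacity {n : ℕ} (R : ℕ → ℕ → ℕ) (U : Set (Fin n)) : ℕ :=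
  ∑ u : Fin n, ∑ v : Fin n, if u ∈ U ∧ v ∉ U then R u v else 0

open Classical in
/-- The indicator function of a vertex set. -/
noncomputable def indicator {n : ℕ} (U : Set (Fin n)) (v : Fin n) : ℕ :=
  if v ∈ U then 1 else 0

/-- Only the arcs `(p, v)` and `(v, p)` change, so a cut changes only if it separates `p` from `v`.
With indicators on both sides the identity needs no subtraction and telescopes along a path. -/
theorem capacity_push {n : ℕ} {R R' : ℕ → ℕ → ℕ} {p v : Fin n} (hpv : p ≠ v)
    (hR : R p v ≠ 0)
    (hR' : ∀ x y, R' x y = if x = p ∧ y = v then R x y - 1 else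
      if x = v ∧ y = p then R x y + 1 else R x y) (U : Set (Fin n)) :
    capacity R' U + indicator U p = capacity R U + indicator U v := by
  classical
  have key : ∀ x y : Fin n, ((if x ∈ U ∧ y ∉ U then R' x y else 0 : ℕ) : ℤ) =
      ((if x ∈ U ∧ y ∉ U then R x y else 0 : ℕ) : ℤ)
      - (if x = p then if y = v then if p ∈ U ∧ v ∉ U then 1 else 0 else 0 else 0)
      + (if x = v then if y = p then if v ∈ U ∧ p ∉ U then 1 else 0 else 0 else 0) := by
    intro x y
    simp only [hR', Fin.val_inj]
    by_cases h1 : x = p ∧ y = v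
    · obtain ⟨rfl, rfl⟩ := h1
      have : ((R x y - 1 : ℕ) : ℤ) = R x y - 1 := by omega
      by_cases hU : x ∈ U ∧ y ∉ U <;> simp [hU, hpv, this]
    · by_cases h2 : x = v ∧ y = p
      · obtain ⟨rfl, rfl⟩ := h2
        by_cases hU : x ∈ U ∧ y ∉ U <;> simp [hU, hpv.symm]
      · simp only [h1, h2, if_false]
        have h1' : ∀ c : ℤ, (if x = p then if y = v then c else 0 else 0) = 0 := by
          intro c
          split_ifs <;> simp_all
        have h2' : ∀ c : ℤ, (if x = v then if y = p then c else 0 else 0) = 0 := by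
          intro c
          split_ifs <;> simp_all
        rw [h1', h2']
        ring
  have hsum : (capacity R' U : ℤ) = capacity R U - (if p ∈ U ∧ v ∉ U then 1 else 0)
      + (if v ∈ U ∧ p ∉ U then 1 else 0) := by
    unfold capacity
    push_cast only [Nat.cast_sum]
    simp only [key, Finset.sum_add_distrib, Finset.sum_sub_distrib]
    simp
  unfold indicator
  by_cases hp : p ∈ U <;> by_cases hv : v ∈ U <;> simp [hp, hv] at hsum ⊢ <;> omega

theorem capacity_eq_zero {n : ℕ} {R : ℕ → ℕ → ℕ} {U : Set (Fin n)}
    (h : ∀ u ∈ U, ∀ v ∉ U, R u v = 0) : capacity R U = 0 := by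
  refine Finset.sum_eq_zero fun u _ => Finset.sum_eq_zero fun v _ => ?_
  split_ifs with huv
  exacts [h u huv.1 v huv.2, rfl]

namespace Instance

variable {I : Instance}

/-- `C` is the adjacency matrix of the graph with edge set `S`. -/
def IsAdj (S : Set I.Edge) (C : ℕ → ℕ → ℕ) : Prop :=
  ∀ u v : Fin I.n, C u v ≤ 1 ∧ (C u v ≠ 0 ↔ ∃ e ∈ S, I.graph.Joins e u v)

theorem IsAdj.capacity_eq {S : Set I.Edge} {C : ℕ → ℕ → ℕ} (h : IsAdj S C)
    (U : Set (Fin I.n)) : capacity C U = (crossing S U).ncard := by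
  classical
  rw [ncard_crossing, Set.ncard_eq_toFinset_card', capacity, ← Fintype.sum_prod_type'
    (f := fun u v : Fin I.n => if u ∈ U ∧ v ∉ U then C u v else 0), Finset.card_eq_sum_ones,
    ← Finset.sum_filter_add_sum_filter_not Finset.univ (· ∈ crossingPairs S U),
    Finset.sum_eq_zero (s := Finset.univ.filter (· ∉ crossingPairs S U)), add_zero]
  · refine Finset.sum_congr (by ext; simp) fun p hp => ?_
    obtain ⟨h1, h2, h3⟩ : p ∈ crossingPairs S U := by simpa using hp
    have := (h p.1 p.2).2.2 h3
    have := (h p.1 p.2).1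
    rw [if_pos ⟨h1, h2⟩]
    omega
  · intro p hp
    have hp' : p ∉ crossingPairs S U := by simpa using hp
    split_ifs with hU
    · by_contra h0
      exact hp' ⟨hU.1, hU.2, (h p.1 p.2).2.1 h0⟩
    · rfl

/-- The residual capacities `R` arise from the adjacency matrix `C` and a flow of value `m`. -/
def IsResidual (C R : ℕ → ℕ → ℕ) (m : ℕ) : Prop :=
  ∀ U : Set (Fin I.n), I.s ∈ U → I.t ∉ U → capacity R U + m = capacity C U

/-- The residual identity gives `m = capacity C U` for the saturated set `U` and `m ≤ capacity C U'`
for any other `U'`; every edge cut contains the crossing set of some `U'`. -/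
theorem IsAdj.isMinCut {S : Set I.Edge} {C R : ℕ → ℕ → ℕ} (h : IsAdj S C) {m : ℕ}
    (hR : I.IsResidual C R m) {U : Set (Fin I.n)} (hs : I.s ∈ U) (ht : I.t ∉ U)
    (hU : ∀ u ∈ U, ∀ v ∉ U, R u v = 0) : I.IsMinCut S (crossing S U) := by
  refine ⟨crossing_subset S U, disconnected_diff_crossing S hs ht, fun F' _ hF' => ?_⟩
  obtain ⟨U', hs', ht', hU'⟩ := hF'.exists_crossing_subset
  have h1 := hR U hs ht
  have h2 := hR U' hs' ht'
  rw [capacity_eq_zero hU] at h1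
  have h3 := Set.ncard_le_ncard hU' (Set.toFinite _)
  rw [h.capacity_eq] at h1 h2
  omega

/-- Bounds the flow value, and with it the number of augmentations. -/
theorem IsAdj.capacity_source_le {S : Set I.Edge} {C : ℕ → ℕ → ℕ} (h : IsAdj S C) :
    capacity C ({I.s} : Set (Fin I.n)) ≤ I.n := by
  rw [h.capacity_eq, ncard_crossing]
  have hsub : crossingPairs S ({I.s} : Set (Fin I.n)) ⊆ (fun v => (I.s, v)) '' Set.univ := by
    rintro ⟨u, v⟩ ⟨hu, -⟩
    exact ⟨v, trivial, Prod.ext (Set.mem_singleton_iff.1 hu).symm rfl⟩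
  refine (Set.ncard_le_ncard hsub (Set.toFinite _)).trans ((Set.ncard_image_le).trans ?_)
  simp

end Instance

end Flow

end LabelCut

/-! ## The program

Registers: `0` to `4` hold the input, `5`, `6`, `7`, `9`, `10`, `11` and `16` are loop counters,
`8` is the current vertex of a traced path, `12` and `13` hold the two sides of the threshold test,
`14` the size of the best solution so far and `15` the size of the current one.
Arrays: `0` is the labelled adjacency matrix, `1` the best solution so far, `2` the current label
set (shifted by one, with `0` marked), `3` the residual capacities, `4` the distances plus one and
`5` the predecessors. -/

namespace LabelCut

open Ram

namespace Program

/-- Mark `0` and no label. -/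
def clear : Prog :=
  .seq (.rep 16 1 (.put 2 (.lit 0) (.add (.var 16) (.lit 1)) (.lit 0)))
    (.put 2 (.lit 0) (.lit 0) (.lit 1))

/-- The adjacency matrix of the graph without the marked labels. -/
def residual : Prog :=
  .rep 6 0 (.rep 7 0 (.put 3 (.var 6) (.var 7)
    (.sub (.lit 1) (.get 2 (.lit 0) (.get 0 (.var 6) (.var 7))))))

/-- In round `i`, reach `v` from `u`. -/
def scan : Prog :=
  -- The two truncated differences together test whether `D u = i + 1`, that is, whether `u` belongs
  -- to the current round.
  .ite (.sub (.get 4 (.lit 0) (.var 6)) (.var 5))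
    (.ite (.sub (.get 4 (.lit 0) (.var 6)) (.add (.var 5) (.lit 1))) .skip
      (.ite (.get 3 (.var 6) (.var 7))
        (.ite (.get 4 (.lit 0) (.var 7)) .skip
          (.seq (.put 4 (.lit 0) (.var 7) (.add (.var 5) (.lit 2)))
            (.put 5 (.lit 0) (.var 7) (.var 6))))
        .skip))
    .skip

/-- Breadth first search from `s`. -/
def bfs : Prog :=
  .seq (.rep 7 0 (.put 4 (.lit 0) (.var 7) (.lit 0)))
    (.seq (.put 4 (.lit 0) (.var 2) (.lit 1))
      (.rep 5 0 (.rep 6 0 (.rep 7 0 scan))))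

/-- Follow the predecessors from `t` to `s` and do `c` at each vertex but the last. -/
def trace (c : Prog) : Prog :=
  .seq (.set 8 (.var 3))
    (.rep 9 0 (.ite (.add (.sub (.var 8) (.var 2)) (.sub (.var 2) (.var 8)))
      (.seq c (.set 8 (.get 5 (.lit 0) (.var 8)))) .skip))

/-- Mark the label of the edge to the current vertex. -/
def mark : Prog :=
  .put 2 (.lit 0) (.get 0 (.get 5 (.lit 0) (.var 8)) (.var 8)) (.lit 1)

/-- Push one unit of flow over the arc to the current vertex. -/
def push : Prog :=
  .seq (.put 3 (.get 5 (.lit 0) (.var 8)) (.var 8)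
      (.sub (.get 3 (.get 5 (.lit 0) (.var 8)) (.var 8)) (.lit 1)))
    (.put 3 (.var 8) (.get 5 (.lit 0) (.var 8))
      (.add (.get 3 (.var 8) (.get 5 (.lit 0) (.var 8))) (.lit 1)))

/-- Multiply register `12` by the `s`-`t` distance. -/
def mulDist : Prog :=
  .seq (.set 13 (.lit 0))
    (.seq (.rep 16 0 (.ite (.sub (.sub (.get 4 (.lit 0) (.var 3)) (.lit 1)) (.var 16))
        (.set 13 (.add (.var 13) (.var 12))) .skip))
      (.set 12 (.var 13)))

/-- Compute both sides of the threshold test. -/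
def sides : Prog :=
  .seq (.seq (.set 12 (.add (.var 10) (.lit 1))) (.seq mulDist (.seq mulDist mulDist)))
    (.seq (.set 13 (.lit 0)) (.rep 16 0 (.set 13 (.add (.var 13) (.var 0)))))

def stageOneBody : Prog :=
  .seq sides (.ite (.get 4 (.lit 0) (.var 3))
    -- With truncated subtraction this is non-zero exactly when register `12` is at most register
    -- `13`.
    (.ite (.sub (.add (.var 13) (.lit 1)) (.var 12))
      (.seq (trace mark) (.seq residual bfs)) .skip) .skip)

def stageOne : Prog := .rep 11 1 stageOneBody

def stageTwoBody : Prog :=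
  .ite (.get 4 (.lit 0) (.var 3)) (.seq (trace push) bfs) .skip

def stageTwo : Prog := .rep 11 0 stageTwoBody

/-- Mark the labels of the edges that leave the set of reached vertices. -/
def markCut : Prog :=
  .rep 6 0 (.rep 7 0 (.ite (.get 4 (.lit 0) (.var 6))
    (.ite (.get 4 (.lit 0) (.var 7)) .skip
      (.put 2 (.lit 0) (.get 0 (.var 6) (.var 7)) (.lit 1))) .skip))

/-- The algorithm for one guess. -/
def solve : Prog :=
  .seq (.seq clear (.seq residual bfs)) (.seq stageOne (.seq stageTwo markCut))

/-- Count the marked labels. -/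
def count : Prog :=
  .seq (.set 15 (.lit 0))
    (.rep 16 1 (.ite (.get 2 (.lit 0) (.add (.var 16) (.lit 1)))
      (.set 15 (.add (.var 15) (.lit 1))) .skip))

/-- Copy the current solution to the output. -/
def save : Prog :=
  .seq (.rep 16 1 (.put 1 (.lit 0) (.var 16) (.get 2 (.lit 0) (.add (.var 16) (.lit 1)))))
    (.set 14 (.var 15))

def mainBody : Prog :=
  .seq solve (.seq count (.ite (.sub (.var 14) (.var 15)) save .skip))

/-- The whole algorithm. -/
def main : Prog :=
  -- The initial value `q + 1` exceeds every solution size, so the first solution is always saved.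
  -- Register `10` starts at `0`; the guess is its value plus one.
  .seq (.set 14 (.add (.var 1) (.lit 1))) (.rep 10 1 mainBody)

theorem main_bounded : main.Bounded := by decide

/-! ### Breadth first search -/

theorem scan_run {n s i u v : ℕ} {ρ : Store} (hi : ρ.var 5 = i) (hu : ρ.var 6 = u)
    (hv : ρ.var 7 = v) (hun : u < n) (hvn : v < n)
    (h : Scanned n s (ρ.mem 3) (ρ.mem 4 0) (ρ.mem 5 0) i u v) :
    Scanned n s (ρ.mem 3) ((scan.run ρ).mem 4 0) ((scan.run ρ).mem 5 0) i u (v + 1) := by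
  by_cases hc : ρ.mem 4 0 u = i + 1 ∧ ρ.mem 3 u v ≠ 0 ∧ ρ.mem 4 0 v = 0
  · refine h.visit hun hc (fun w => ?_) (fun w => ?_) <;>
    · simp [scan, Prog.run, Expr.eval, hi, hu, hv, hc, Store.putMem]
  · have hrun : scan.run ρ = ρ := by
      simp only [scan, Prog.run, Expr.eval, hi, hu, hv]
      split_ifs <;> first | rfl | (exfalso; apply hc; omega)
    rw [hrun]
    exact h.skip hvn hc

theorem bfs_run {n s : ℕ} {σ : Store} (hn : σ.var 0 = n) (hs : σ.var 2 = s) (hsn : s < n) :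
    IsBfs n s (σ.mem 3) ((bfs.run σ).mem 4 0) ((bfs.run σ).mem 5 0) := by
  have h1 : ∀ v < n, ((Prog.rep 7 0 (.put 4 (.lit 0) (.var 7) (.lit 0))).run σ).mem 4 0 v = 0 := by
    refine Prog.rep_induction (fun i ρ => ∀ v < i, ρ.mem 4 0 v = 0)
      (Q := fun ρ => ∀ v < n, ρ.mem 4 0 v = 0) (by simp) ?_ ?_
    · intro i _ ρ _ ih v hv
      by_cases hvi : v = i
      · simp [Prog.run, Expr.eval, Store.putMem, Store.setVar, hvi]
      · simpa [Prog.run, Expr.eval, Store.putMem, Store.setVar, hvi] using ih v (by omega)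
    · intro ρ _ h
      rwa [hn] at h
  obtain ⟨σ₁, hσ₁⟩ : ∃ σ₁, σ₁ = (Prog.rep 7 0 (.put 4 (.lit 0) (.var 7) (.lit 0))).run σ :=
    ⟨_, rfl⟩
  have hA := (Prog.rep 7 0 (.put 4 (.lit 0) (.var 7) (.lit 0))).agree_run σ
  rw [← hσ₁] at h1 hA
  have hn₁ : σ₁.var 0 = n := (hA.1 0 (by decide)).trans hn
  have hs₁ : σ₁.var 2 = s := (hA.1 2 (by decide)).trans hs
  have hrun : bfs.run σ = (Prog.rep 5 0 (.rep 6 0 (.rep 7 0 scan))).run (σ₁.putMem 4 0 s 1) := by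
    rw [hσ₁] at hs₁ ⊢
    rw [← hs₁]
    rfl
  rw [hrun]
  obtain ⟨σ₂, hσ₂⟩ : ∃ σ₂, σ₂ = σ₁.putMem 4 0 s 1 := ⟨_, rfl⟩
  have hstart : Scanned n s (σ.mem 3) (σ₂.mem 4 0) (σ₂.mem 5 0) 0 0 0 := by
    refine Scanned.start (fun v hv => ?_) hsn
    by_cases hvs : v = s <;> simp [hσ₂, Store.putMem, hvs, h1 v hv]
  have hn₂ : σ₂.var 0 = n := by rw [hσ₂]; exact hn₁
  have hR₂ : σ₂.mem 3 = σ.mem 3 := by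
    rw [← hA.2 3 (by decide), hσ₂]
    simp [Store.putMem]
  rw [← hσ₂]
  refine Prog.rep_induction (fun i ρ => Scanned n s (σ.mem 3) (ρ.mem 4 0) (ρ.mem 5 0) i 0 0)
    (Q := fun ρ => IsBfs n s (σ.mem 3) (ρ.mem 4 0) (ρ.mem 5 0)) hstart ?_ ?_
  · intro i _ ρ hρ hi
    refine Prog.rep_induction
      (fun u ρ => Scanned n s (σ.mem 3) (ρ.mem 4 0) (ρ.mem 5 0) i u 0)
      (Q := fun ρ => Scanned n s (σ.mem 3) (ρ.mem 4 0) (ρ.mem 5 0) (i + 1) 0 0) hi ?_ ?_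
    · intro u hu ρ' hρ' hiu
      refine Prog.rep_induction
        (fun v ρ => Scanned n s (σ.mem 3) (ρ.mem 4 0) (ρ.mem 5 0) i u v)
        (Q := fun ρ => Scanned n s (σ.mem 3) (ρ.mem 4 0) (ρ.mem 5 0) i (u + 1) 0) hiu ?_ ?_
      · intro v hv ρ'' hρ'' hiuv
        have e0 : ρ'.var 0 = n :=
          (hρ'.1 0 (by decide)).trans ((hρ.1 0 (by decide)).trans hn₂)
        have e1 : ρ.var 0 = n := (hρ.1 0 (by decide)).trans hn₂
        have e3 : ρ''.mem 3 = σ.mem 3 := by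
          rw [hρ''.2 3 (by decide)]
          exact (hρ'.2 3 (by decide)).trans ((hρ.2 3 (by decide)).trans hR₂)
        have e5 : ρ''.var 5 = i := by
          rw [hρ''.1 5 (by decide)]
          exact hρ'.1 5 (by decide)
        have e6 : ρ''.var 6 = u := hρ''.1 6 (by decide)
        have hu' : u < n := e1 ▸ hu
        have hv' : v < n := e0 ▸ hv
        rw [← e3] at hiuv ⊢
        exact scan_run (ρ := ρ''.setVar 7 v) e5 e6 rfl hu' hv' hiuv
      · intro ρ'' _ h
        have e0 : (ρ'.setVar 6 u).var 0 = n :=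
          (hρ'.1 0 (by decide)).trans ((hρ.1 0 (by decide)).trans hn₂)
        rw [e0] at h
        exact h.next_row
    · intro ρ' _ h
      have e0 : (ρ.setVar 5 i).var 0 = n := (hρ.1 0 (by decide)).trans hn₂
      rw [e0] at h
      exact h.next_round
  · intro ρ _ h
    rw [hn₂] at h
    exact h.isBfs

/-! ### Elementary parts -/

theorem residual_run {n : ℕ} {σ : Store} (hn : σ.var 0 = n) :
    ∀ u < n, ∀ v < n, (residual.run σ).mem 3 u v = 1 - σ.mem 2 0 (σ.mem 0 u v) := by
  refine Prog.rep_induction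
    (fun i ρ => ∀ u < i, ∀ v < n, ρ.mem 3 u v = 1 - σ.mem 2 0 (σ.mem 0 u v))
    (Q := fun ρ => ∀ u < n, ∀ v < n, ρ.mem 3 u v = 1 - σ.mem 2 0 (σ.mem 0 u v))
    (by simp) ?_ ?_
  · intro i _ ρ hρ hi
    have e0 : (ρ.setVar 6 i).var 0 = n := (hρ.1 0 (by decide)).trans hn
    refine Prog.rep_induction
      (fun j ρ' => ∀ u v, v < n → u < i ∨ u = i ∧ v < j →
        ρ'.mem 3 u v = 1 - σ.mem 2 0 (σ.mem 0 u v))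
      (Q := fun ρ => ∀ u < i + 1, ∀ v < n, ρ.mem 3 u v = 1 - σ.mem 2 0 (σ.mem 0 u v))
      (fun u v hv huv => hi u (by omega) v hv) ?_ ?_
    · intro j _ ρ' hρ' hj u v hv huv
      have e6 : ρ'.var 6 = i := hρ'.1 6 (by decide)
      have m0 : ρ'.mem 0 = σ.mem 0 := (hρ'.2 0 (by decide)).trans (hρ.2 0 (by decide))
      have m2 : ρ'.mem 2 = σ.mem 2 := (hρ'.2 2 (by decide)).trans (hρ.2 2 (by decide))
      by_cases hc : u = i ∧ v = j
      · obtain ⟨rfl, rfl⟩ := hc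
        simp [Prog.run, Expr.eval, Store.putMem, Store.setVar, e6, m0, m2]
      · have := hj u v hv (by omega)
        simpa [Prog.run, Expr.eval, Store.putMem, Store.setVar, e6, hc] using this
    · intro ρ' _ h u hu v hv
      rw [e0] at h
      exact h u v hv (by omega)
  · intro ρ _ h
    rwa [hn] at h

/-- An induction principle along the predecessor path: `J v m` relates the current vertex to the
memory and is carried from `t` to `s`. -/
theorem trace_run {c : Prog} {n s t : ℕ} {σ : Store}
    (hw : 0 ∉ c.writes ∧ 2 ∉ c.writes ∧ 8 ∉ c.writes ∧ 9 ∉ c.writes)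
    (ha : 4 ∉ c.arrays ∧ 5 ∉ c.arrays) (hn : σ.var 0 = n) (hs : σ.var 2 = s) (ht : σ.var 3 = t)
    (htn : t < n) {R : ℕ → ℕ → ℕ} (hL : Layered n s R (σ.mem 4 0) (σ.mem 5 0))
    (hDt : σ.mem 4 0 t ≠ 0) (J : ℕ → (ℕ → ℕ → ℕ → ℕ) → Prop) (start : J t σ.mem)
    (step : ∀ ρ v, (trace c).Agree σ ρ → v < n → 2 ≤ σ.mem 4 0 v → ρ.var 8 = v → J v ρ.mem →
      J (σ.mem 5 0 v) (c.run ρ).mem) :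
    J s ((trace c).run σ).mem := by
  obtain ⟨σ₁, hσ₁⟩ : ∃ σ₁, σ₁ = σ.setVar 8 t := ⟨_, rfl⟩
  have hrun : (trace c).run σ =
      (Prog.rep 9 0 (.ite (.add (.sub (.var 8) (.var 2)) (.sub (.var 2) (.var 8)))
      (.seq c (.set 8 (.get 5 (.lit 0) (.var 8)))) .skip)).run σ₁ := by
    rw [hσ₁, ← ht]
    rfl
  have hle := hL.le htn
  rw [hrun]
  refine Prog.rep_induction
    (fun i ρ => ∃ v < n, ρ.var 8 = v ∧ σ.mem 4 0 v ≠ 0 ∧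
      (v = s ∨ σ.mem 4 0 v + i ≤ σ.mem 4 0 t) ∧ J v ρ.mem)
    (Q := fun ρ => J s ρ.mem) ?_ ?_ ?_
  · exact ⟨t, htn, by simp [hσ₁, Store.setVar], hDt, Or.inr le_rfl, by rw [hσ₁]; exact start⟩
  · rintro i _ ρ hρ ⟨v, hvn, h8, hDv, hv, hJ⟩
    have hA : (trace c).Agree σ (ρ.setVar 9 i) := by
      refine ⟨fun x hx => ?_, fun a h => ?_⟩
      · have hx' : x ≠ 8 ∧ x ≠ 9 ∧ x ∉ c.writes := by
          simpa [trace, Prog.writes, and_comm, and_left_comm, and_assoc] using hx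
        have h1 := hρ.1 x (by simp [Prog.writes, hx'])
        simpa [Store.setVar, hx', hσ₁] using h1
      · have ha' : a ∉ c.arrays := by simpa [trace, Prog.arrays] using h
        have h1 := hρ.2 a (by simp [Prog.arrays, ha'])
        simpa [Store.setVar, hσ₁] using h1
    have e2 : (ρ.setVar 9 i).var 2 = s := by
      rw [← hs]
      exact hA.1 2 (by simp [trace, Prog.writes, hw])
    have e8 : (ρ.setVar 9 i).var 8 = v := h8
    by_cases hvs : v = s
    · have hskip : (Expr.add (.sub (.var 8) (.var 2)) (.sub (.var 2) (.var 8))).eval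
          (ρ.setVar 9 i) = 0 := by
        simp [Expr.eval, e2, e8, hvs]
      simp only [Prog.run, hskip, ne_eq, not_true_eq_false, if_false]
      exact ⟨v, hvn, e8, hDv, Or.inl hvs, hJ⟩
    · have hgo : (Expr.add (.sub (.var 8) (.var 2)) (.sub (.var 2) (.var 8))).eval
          (ρ.setVar 9 i) ≠ 0 := by
        simp only [Expr.eval, e2, e8]
        omega
      have h2 : 2 ≤ σ.mem 4 0 v := by
        by_contra hlt
        exact hvs (hL.root_unique v hvn (by omega))
      obtain ⟨hPn, hPD, _⟩ := hL.pred v hvn h2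
      simp only [Prog.run, hgo, ne_eq, not_false_eq_true, if_true]
      have e5 : (c.run (ρ.setVar 9 i)).mem 5 = σ.mem 5 := by
        rw [(c.agree_run _).2 5 ha.2]
        exact hA.2 5 (by simp [trace, Prog.arrays, ha])
      have e8' : (c.run (ρ.setVar 9 i)).var 8 = v := by
        rw [(c.agree_run _).1 8 hw.2.2.1, e8]
      have hval : (Expr.get 5 (.lit 0) (.var 8)).eval (c.run (ρ.setVar 9 i)) = σ.mem 5 0 v := by
        simp only [Expr.eval, e5, e8']
      refine ⟨σ.mem 5 0 v, hPn, by rw [hval]; simp [Store.setVar], by omega,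
        Or.inr (by omega), ?_⟩
      exact step _ v hA hvn h2 e8 hJ
  · rintro ρ _ ⟨v, hvn, _, hDv, hv, hJ⟩
    have e0 : σ₁.var 0 = n := by rw [hσ₁]; exact hn
    rw [e0] at hv
    -- Each proper step lowers the distance entry by one; after `n` rounds, `v ≠ s` would force a
    -- non-zero entry plus `n` to be at most `n`.
    obtain rfl : v = s := by omega
    exact hJ

/-- The indicator terms telescope to the value `1` at `s` minus `0` at `t`. The second half of the
invariant says that arcs into vertices no farther than the current one have lost no capacity, so the
next arc of the path is still positive. -/
theorem push_run {n s t : ℕ} {σ : Store} (hn : σ.var 0 = n) (hs : σ.var 2 = s)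
    (ht : σ.var 3 = t) (htn : t < n) (hL : Layered n s (σ.mem 3) (σ.mem 4 0) (σ.mem 5 0))
    (hDt : σ.mem 4 0 t ≠ 0) (U : Set (Fin n)) (hsn : s < n) (hsU : (⟨s, hsn⟩ : Fin n) ∈ U)
    (htU : (⟨t, htn⟩ : Fin n) ∉ U) :
    capacity (((trace push).run σ).mem 3) U + 1 = capacity (σ.mem 3) U := by
  have h := trace_run (c := push) (by decide) (by decide) hn hs ht htn hL hDt
    (fun v m => (∀ hv : v < n, capacity (m 3) U + indicator U ⟨v, hv⟩ = capacity (σ.mem 3) U) ∧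
      ∀ x w, σ.mem 4 0 w ≤ σ.mem 4 0 v → σ.mem 3 x w ≤ m 3 x w)
    ⟨fun _ => by simp [indicator, htU], fun _ _ _ => le_rfl⟩ ?_
  · simpa [indicator, hsU] using h.1 hsn
  · rintro ρ v hA hvn h2 h8 ⟨hcap, hle⟩
    obtain ⟨hPn, hPD, hR⟩ := hL.pred v hvn h2
    have e5 : ρ.mem 5 = σ.mem 5 := hA.2 5 (by decide)
    have hne : σ.mem 5 0 v ≠ v := fun h => by
      rw [h] at hPD
      omega
    have hR' : ∀ x y, (push.run ρ).mem 3 x y =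
        if x = σ.mem 5 0 v ∧ y = v then ρ.mem 3 x y - 1 else
          if x = v ∧ y = σ.mem 5 0 v then ρ.mem 3 x y + 1 else ρ.mem 3 x y := by
      intro x y
      simp only [push, Prog.run, Expr.eval, Store.putMem, h8, e5, true_and]
      by_cases h1 : x = v ∧ y = σ.mem 5 0 v
      · obtain ⟨rfl, rfl⟩ := h1
        simp [hne, hne.symm]
      · by_cases h3 : x = σ.mem 5 0 v ∧ y = v
        · obtain ⟨rfl, rfl⟩ := h3
          simp [hne, hne.symm]
        · simp [h1, h3]
    have hpos : ρ.mem 3 (σ.mem 5 0 v) v ≠ 0 := by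
      have := hle (σ.mem 5 0 v) v le_rfl
      omega
    refine ⟨fun hP => ?_, fun x w hw => ?_⟩
    · rw [← hcap hvn]
      exact capacity_push (R := ρ.mem 3) (p := ⟨_, hP⟩) (v := ⟨v, hvn⟩)
        (fun h => hne (Fin.val_eq_of_eq h)) hpos hR' U
    · have hwv : w ≠ v := by
        rintro rfl
        omega
      have := hle x w (by omega)
      rw [hR']
      split_ifs <;> omega

theorem mulDist_run {n t : ℕ} {σ : Store} (hn : σ.var 0 = n) (ht : σ.var 3 = t)
    (hD : σ.mem 4 0 t ≤ n) :
    (mulDist.run σ).var 12 = (σ.mem 4 0 t - 1) * σ.var 12 := by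
  have key : ((Prog.rep 16 0 (.ite (.sub (.sub (.get 4 (.lit 0) (.var 3)) (.lit 1)) (.var 16))
        (.set 13 (.add (.var 13) (.var 12))) .skip)).run (σ.setVar 13 0)).var 13 =
      (σ.mem 4 0 t - 1) * σ.var 12 := by
    refine Prog.rep_induction (fun i ρ => ρ.var 13 = min i (σ.mem 4 0 t - 1) * σ.var 12)
      (Q := fun ρ => ρ.var 13 = (σ.mem 4 0 t - 1) * σ.var 12) (by simp [Store.setVar]) ?_ ?_
    · intro i _ ρ hρ hi
      have e12 : ρ.var 12 = σ.var 12 := hρ.1 12 (by decide)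
      have e3 : ρ.var 3 = t := (hρ.1 3 (by decide)).trans ht
      have m4 : ρ.mem 4 = σ.mem 4 := hρ.2 4 (by decide)
      by_cases hc : i < σ.mem 4 0 t - 1
      · have hc' : σ.mem 4 0 t - 1 - i ≠ 0 := by omega
        rw [min_eq_left hc.le] at hi
        rw [min_eq_left hc]
        simp [Prog.run, Expr.eval, Store.setVar, e3, m4, e12, hc', hi]
        ring
      · have hc' : σ.mem 4 0 t - 1 - i = 0 := by omega
        rw [min_eq_right (by omega)] at hi ⊢
        simp [Prog.run, Expr.eval, Store.setVar, e3, m4, hc', hi]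
    · intro ρ _ h
      have e0 : (σ.setVar 13 0).var 0 = n := hn
      rw [e0, min_eq_right (by omega)] at h
      exact h
  exact key

theorem sides_run {n t : ℕ} {σ : Store} (hn : σ.var 0 = n) (ht : σ.var 3 = t)
    (hD : σ.mem 4 0 t ≤ n) :
    (sides.run σ).var 12 = (σ.mem 4 0 t - 1) ^ 3 * (σ.var 10 + 1) ∧
      (sides.run σ).var 13 = n ^ 2 := by
  have hmul : ∀ ρ : Store, ρ.var 0 = n → ρ.var 3 = t → ρ.mem 4 = σ.mem 4 →
      (mulDist.run ρ).var 12 = (σ.mem 4 0 t - 1) * ρ.var 12 := fun ρ h0 h3 h4 => by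
    rw [← h4] at hD ⊢
    exact mulDist_run h0 h3 hD
  have hmulA := fun ρ : Store => mulDist.agree_run ρ
  have m0 : ∀ ρ : Store, (mulDist.run ρ).var 0 = ρ.var 0 := fun ρ => (hmulA ρ).1 0 (by decide)
  have m3 : ∀ ρ : Store, (mulDist.run ρ).var 3 = ρ.var 3 := fun ρ => (hmulA ρ).1 3 (by decide)
  have m4 : ∀ ρ : Store, (mulDist.run ρ).mem 4 = ρ.mem 4 := fun ρ => (hmulA ρ).2 4 (by decide)
  obtain ⟨σ₁, hσ₁⟩ : ∃ σ₁, σ₁ = σ.setVar 12 (σ.var 10 + 1) := ⟨_, rfl⟩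
  have a0 : σ₁.var 0 = n := by rw [hσ₁]; exact hn
  have a3 : σ₁.var 3 = t := by rw [hσ₁]; exact ht
  have a4 : σ₁.mem 4 = σ.mem 4 := by rw [hσ₁]; rfl
  have a12 : σ₁.var 12 = σ.var 10 + 1 := by simp [hσ₁, Store.setVar]
  obtain ⟨σ₂, hσ₂⟩ : ∃ σ₂, σ₂ = mulDist.run (mulDist.run (mulDist.run σ₁)) := ⟨_, rfl⟩
  have hrun : sides.run σ = (Prog.rep 16 0 (.set 13 (.add (.var 13) (.var 0)))).run
      (σ₂.setVar 13 0) := by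
    rw [hσ₂, hσ₁]
    rfl
  have b12 : σ₂.var 12 = (σ.mem 4 0 t - 1) ^ 3 * (σ.var 10 + 1) := by
    rw [hσ₂, hmul _ (by simp [m0, a0]) (by simp [m3, a3]) (by simp [m4, a4]),
      hmul _ (by simp [m0, a0]) (by simp [m3, a3]) (by simp [m4, a4]),
      hmul _ a0 a3 a4, a12]
    ring
  have b0 : σ₂.var 0 = n := by simp [hσ₂, m0, a0]
  rw [hrun]
  refine Prog.rep_induction
    (fun i ρ => ρ.var 12 = (σ.mem 4 0 t - 1) ^ 3 * (σ.var 10 + 1) ∧ ρ.var 13 = i * n)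
    (Q := fun ρ => ρ.var 12 = (σ.mem 4 0 t - 1) ^ 3 * (σ.var 10 + 1) ∧ ρ.var 13 = n ^ 2)
    ⟨b12, by simp [Store.setVar]⟩ ?_ ?_
  · rintro i _ ρ hρ ⟨h12, h13⟩
    have e0 : ρ.var 0 = n := (hρ.1 0 (by decide)).trans b0
    refine ⟨h12, ?_⟩
    simp [Prog.run, Expr.eval, Store.setVar, e0, h13]
    ring
  · rintro ρ _ ⟨h12, h13⟩
    have e0 : (σ₂.setVar 13 0).var 0 = n := b0
    rw [e0] at h13
    exact ⟨h12, h13.trans (sq n).symm⟩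

theorem clear_run {q : ℕ} {σ : Store} (hq : σ.var 1 = q) :
    (clear.run σ).mem 2 0 0 ≠ 0 ∧ ∀ l < q, (clear.run σ).mem 2 0 (l + 1) = 0 := by
  have key : ∀ l < q, ((Prog.rep 16 1 (.put 2 (.lit 0) (.add (.var 16) (.lit 1)) (.lit 0))).run
      σ).mem 2 0 (l + 1) = 0 := by
    refine Prog.rep_induction (fun i ρ => ∀ l < i, ρ.mem 2 0 (l + 1) = 0)
      (Q := fun ρ => ∀ l < q, ρ.mem 2 0 (l + 1) = 0) (by simp) ?_ ?_
    · intro i _ ρ _ hi l hl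
      by_cases hli : l = i
      · simp [Prog.run, Expr.eval, Store.putMem, Store.setVar, hli]
      · simpa [Prog.run, Expr.eval, Store.putMem, Store.setVar, hli] using hi l (by omega)
    · intro ρ _ h
      rwa [hq] at h
  refine ⟨?_, fun l hl => ?_⟩
  · simp [clear, Prog.run, Expr.eval, Store.putMem]
  · exact (if_neg (t := 1) (show ¬ (2 = 2 ∧ 0 = 0 ∧ l + 1 = 0) by omega)).trans (key l hl)

theorem markCut_run {n : ℕ} {σ : Store} (hn : σ.var 0 = n) (x : ℕ) :
    (markCut.run σ).mem 2 0 x ≠ 0 ↔ σ.mem 2 0 x ≠ 0 ∨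
      ∃ u < n, ∃ v < n, σ.mem 4 0 u ≠ 0 ∧ σ.mem 4 0 v = 0 ∧ σ.mem 0 u v = x := by
  refine Prog.rep_induction
    (fun i ρ => ρ.mem 2 0 x ≠ 0 ↔ σ.mem 2 0 x ≠ 0 ∨
      ∃ u < i, ∃ v < n, σ.mem 4 0 u ≠ 0 ∧ σ.mem 4 0 v = 0 ∧ σ.mem 0 u v = x)
    (Q := fun ρ => ρ.mem 2 0 x ≠ 0 ↔ σ.mem 2 0 x ≠ 0 ∨
      ∃ u < n, ∃ v < n, σ.mem 4 0 u ≠ 0 ∧ σ.mem 4 0 v = 0 ∧ σ.mem 0 u v = x) (by simp) ?_ ?_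
  · intro i _ ρ hρ hi
    have e0 : (ρ.setVar 6 i).var 0 = n := (hρ.1 0 (by decide)).trans hn
    refine Prog.rep_induction
      (fun j ρ' => ρ'.mem 2 0 x ≠ 0 ↔ ρ.mem 2 0 x ≠ 0 ∨
        ∃ v < j, σ.mem 4 0 i ≠ 0 ∧ σ.mem 4 0 v = 0 ∧ σ.mem 0 i v = x)
      (Q := fun ρ => ρ.mem 2 0 x ≠ 0 ↔ σ.mem 2 0 x ≠ 0 ∨
        ∃ u < i + 1, ∃ v < n, σ.mem 4 0 u ≠ 0 ∧ σ.mem 4 0 v = 0 ∧ σ.mem 0 u v = x)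
      (by simp [Store.setVar]) ?_ ?_
    · intro j _ ρ' hρ' hj
      have e6 : ρ'.var 6 = i := hρ'.1 6 (by decide)
      have m0 : ρ'.mem 0 = σ.mem 0 := (hρ'.2 0 (by decide)).trans (hρ.2 0 (by decide))
      have m4 : ρ'.mem 4 = σ.mem 4 := (hρ'.2 4 (by decide)).trans (hρ.2 4 (by decide))
      have hrun : (Prog.run (.ite (.get 4 (.lit 0) (.var 6)) (.ite (.get 4 (.lit 0) (.var 7)) .skip
          (.put 2 (.lit 0) (.get 0 (.var 6) (.var 7)) (.lit 1))) .skip)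
          (ρ'.setVar 7 j)).mem 2 0 x ≠ 0 ↔ ρ'.mem 2 0 x ≠ 0 ∨
          σ.mem 4 0 i ≠ 0 ∧ σ.mem 4 0 j = 0 ∧ σ.mem 0 i j = x := by
        by_cases h1 : σ.mem 4 0 i = 0
        · simp [Prog.run, Expr.eval, Store.setVar, e6, m4, h1]
        · by_cases h2 : σ.mem 4 0 j = 0
          · by_cases h3 : x = σ.mem 0 i j
            · simp [Prog.run, Expr.eval, Store.setVar, Store.putMem, e6, m0, m4, h1, h2, h3]
            · simp [Prog.run, Expr.eval, Store.setVar, Store.putMem, e6, m0, m4, h1, h2, h3,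
                Ne.symm h3]
          · simp [Prog.run, Expr.eval, Store.setVar, e6, m4, h1, h2]
      rw [hrun, hj, or_assoc]
      refine or_congr_right ⟨?_, ?_⟩
      · rintro (⟨v, hv, h⟩ | h)
        exacts [⟨v, by omega, h⟩, ⟨j, by omega, h⟩]
      · rintro ⟨v, hv, h⟩
        rcases Nat.lt_succ_iff_lt_or_eq.1 hv with hv | rfl
        exacts [Or.inl ⟨v, hv, h⟩, Or.inr h]
    · intro ρ' _ h
      rw [e0] at h
      change ρ'.mem 2 0 x ≠ 0 ↔ _
      rw [h, hi, or_assoc]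
      refine or_congr_right ⟨?_, ?_⟩
      · rintro (⟨u, hu, hx⟩ | hx)
        exacts [⟨u, by omega, hx⟩, ⟨i, by omega, hx⟩]
      · rintro ⟨u, hu, hx⟩
        rcases Nat.lt_succ_iff_lt_or_eq.1 hu with hu | rfl
        exacts [Or.inl ⟨u, hu, hx⟩, Or.inr hx]
  · intro ρ _ h
    rwa [hn] at h

theorem count_run {q : ℕ} {σ : Store} (hq : σ.var 1 = q) :
    (count.run σ).var 15 = ∑ l ∈ Finset.range q, if σ.mem 2 0 (l + 1) ≠ 0 then 1 else 0 := by
  refine Prog.rep_induction (σ := σ.setVar 15 0)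
    (fun i ρ => ρ.var 15 = ∑ l ∈ Finset.range i, if σ.mem 2 0 (l + 1) ≠ 0 then 1 else 0)
    (Q := fun ρ => ρ.var 15 = ∑ l ∈ Finset.range q, if σ.mem 2 0 (l + 1) ≠ 0 then 1 else 0)
    (by simp [Store.setVar]) ?_ ?_
  · intro i _ ρ hρ hi
    have m2 : ρ.mem 2 = σ.mem 2 := hρ.2 2 (by decide)
    rw [Finset.sum_range_succ, ← hi]
    by_cases h : σ.mem 2 0 (i + 1) = 0 <;>
      simp [Prog.run, Expr.eval, Store.setVar, m2, h]
  · intro ρ _ h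
    have e1 : (σ.setVar 15 0).var 1 = q := hq
    rw [e1] at h
    exact h

theorem save_run {q : ℕ} {σ : Store} (hq : σ.var 1 = q) :
    (save.run σ).var 14 = σ.var 15 ∧ ∀ l < q, (save.run σ).mem 1 0 l = σ.mem 2 0 (l + 1) := by
  refine Prog.rep_induction
    (fun i ρ => ρ.var 15 = σ.var 15 ∧ ∀ l < i, ρ.mem 1 0 l = σ.mem 2 0 (l + 1))
    (Q := fun ρ => (ρ.setVar 14 (ρ.var 15)).var 14 = σ.var 15 ∧
      ∀ l < q, (ρ.setVar 14 (ρ.var 15)).mem 1 0 l = σ.mem 2 0 (l + 1))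
    ⟨rfl, by simp⟩ ?_ ?_
  · rintro i _ ρ hρ ⟨h15, hi⟩
    have m2 : ρ.mem 2 = σ.mem 2 := hρ.2 2 (by decide)
    refine ⟨h15, fun l hl => ?_⟩
    by_cases hli : l = i
    · simp [Prog.run, Expr.eval, Store.putMem, Store.setVar, hli, m2]
    · simpa [Prog.run, Expr.eval, Store.putMem, Store.setVar, hli] using hi l (by omega)
  · rintro ρ _ ⟨h15, h⟩
    rw [hq] at h
    exact ⟨by simpa [Store.setVar] using h15, h⟩

end Program

end LabelCut

/-! ### Reading the arrays of a store as data of the instance -/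

namespace LabelCut

open Ram

namespace Instance

variable {I : Instance}

theorem entry_eq {u v : Fin I.n} {e : I.Edge} (h : I.graph.Joins e u v) :
    I.entry u v = I.label e + 1 := by
  have hex : ∃ e : I.Edge, ∃ x y : Fin I.n, (x : ℕ) = u ∧ (y : ℕ) = v ∧ I.graph.Joins e x y :=
    ⟨e, u, v, rfl, rfl, h⟩
  rw [entry, dif_pos hex]
  obtain ⟨x, y, hx, hy, hxy⟩ := hex.choose_spec
  rw [Fin.val_inj] at hx hy
  subst hx hy
  rw [hxy.edge_unique h]

theorem entry_ne_zero {u v : Fin I.n} (h : I.entry u v ≠ 0) :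
    ∃ e : I.Edge, I.graph.Joins e u v := by
  rw [entry] at h
  split_ifs at h with hex
  · obtain ⟨e, x, y, hx, hy, hxy⟩ := hex
    rw [Fin.val_inj] at hx hy
    subst hx hy
    exact ⟨e, hxy⟩
  · exact absurd rfl h

/-- The non-zero entries of `row` mark `0` and the labels in `A`, shifted by one. -/
def Marks (row : ℕ → ℕ) (A : Set (Fin I.q)) : Prop :=
  row 0 ≠ 0 ∧ ∀ l : Fin I.q, row (l + 1) ≠ 0 ↔ l ∈ A

/-- An absent arc has entry `0`, and cell `0` is always marked; so absent arcs and arcs with removed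
labels get capacity `0` by the same formula. -/
theorem Marks.isAdj {row : ℕ → ℕ} {A : Set (Fin I.q)} (h : Marks row A) {C : ℕ → ℕ → ℕ}
    (hC : ∀ u < I.n, ∀ v < I.n, C u v = 1 - row (I.entry u v)) :
    IsAdj {e | I.label e ∉ A} C := by
  intro u v
  rw [hC u u.2 v v.2]
  refine ⟨Nat.sub_le _ _, fun hne => ?_, ?_⟩
  · have hrow : row (I.entry u v) = 0 := by omega
    obtain ⟨e, he⟩ := entry_ne_zero fun h0 => h.1 (by rwa [h0] at hrow)
    refine ⟨e, fun hA => (h.2 _).2 hA ?_, he⟩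
    rwa [entry_eq he] at hrow
  · rintro ⟨e, heA, he⟩
    have hrow : row (I.label e + 1) = 0 := by
      by_contra hne
      exact heA ((h.2 _).1 hne)
    rw [entry_eq he, hrow]
    exact one_ne_zero

theorem Marks.sum_eq {row : ℕ → ℕ} {A : Set (Fin I.q)} (h : Marks row A) :
    (∑ l ∈ Finset.range I.q, if row (l + 1) ≠ 0 then 1 else 0) = A.ncard := by
  classical
  rw [← Fin.sum_univ_eq_sum_range (fun l => if row (l + 1) ≠ 0 then 1 else 0), Finset.sum_boole,
    Set.ncard_eq_toFinset_card', Nat.cast_id]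
  congr 1
  ext l
  simp [← h.2 l]

/-- The lower bound on walk lengths that makes the path traced from `t` a shortest one. -/
theorem IsBfs.le_length {S : Set I.Edge} {C : ℕ → ℕ → ℕ} (hC : IsAdj S C) {s : ℕ} {D P : ℕ → ℕ}
    (h : IsBfs I.n s C D P) {u v : Fin I.n} {Q : List I.Edge} (hQ : I.Walk S u v Q)
    (hu : D u ≠ 0) : D v ≠ 0 ∧ D v ≤ D u + Q.length := by
  induction hQ with
  | nil => exact ⟨hu, le_rfl⟩
  | @cons u w v e Q he hj _ ih =>
    obtain ⟨h1, h2⟩ := h.closed u u.2 w w.2 hu ((hC u w).2.2 ⟨e, he, hj⟩)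
    obtain ⟨h3, h4⟩ := ih h1
    refine ⟨h3, ?_⟩
    rw [List.length_cons]
    omega

/-- The program has the instance `I` in its input registers and array. -/
structure Loaded (I : Instance) (σ : Store) : Prop where
  n : σ.var 0 = I.n
  q : σ.var 1 = I.q
  s : σ.var 2 = I.s
  t : σ.var 3 = I.t
  entry : σ.mem 0 = I.entry

theorem Loaded.of_agree {σ ρ : Store} {p : Prog} (h : Loaded I σ) (hA : p.Agree σ ρ)
    (hp : (0 ∉ p.writes ∧ 1 ∉ p.writes ∧ 2 ∉ p.writes ∧ 3 ∉ p.writes) ∧ 0 ∉ p.arrays) :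
    Loaded I ρ :=
  ⟨(hA.1 0 hp.1.1).trans h.n, (hA.1 1 hp.1.2.1).trans h.q, (hA.1 2 hp.1.2.2.1).trans h.s,
    (hA.1 3 hp.1.2.2.2).trans h.t, (hA.2 0 hp.2).trans h.entry⟩

theorem Loaded.setVar {σ : Store} (h : Loaded I σ) {x : ℕ}
    (hx : 0 ≠ x ∧ 1 ≠ x ∧ 2 ≠ x ∧ 3 ≠ x) (v : ℕ) : Loaded I (σ.setVar x v) :=
  ⟨(if_neg hx.1).trans h.n, (if_neg hx.2.1).trans h.q, (if_neg hx.2.2.1).trans h.s,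
    (if_neg hx.2.2.2).trans h.t, h.entry⟩

/-- Stage one with guess `k` can be in the state given by the arrays `m`. -/
structure AtStageOne (k h : ℕ) (S : Set I.Edge) (A : Set (Fin I.q)) (m : ℕ → ℕ → ℕ → ℕ) :
    Prop where
  stage : I.StageOne k h S A
  marks : Marks (m 2 0) A
  adj : IsAdj S (m 3)
  search : IsBfs I.n I.s (m 3) (m 4 0) (m 5 0)

theorem AtStageOne.congr {k h : ℕ} {S : Set I.Edge} {A : Set (Fin I.q)} {m m' : ℕ → ℕ → ℕ → ℕ}
    (H : AtStageOne k h S A m) (h2 : m' 2 = m 2) (h3 : m' 3 = m 3) (h4 : m' 4 = m 4)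
    (h5 : m' 5 = m 5) : AtStageOne k h S A m' :=
  ⟨H.stage, h2 ▸ H.marks, h3 ▸ H.adj, by rw [h3, h4, h5]; exact H.search⟩

end Instance

open Instance

namespace Program

variable {I : Instance}

/-! ### Stage one -/

theorem residual_bfs_run {σ : Store} (hI : Loaded I σ) {A : Set (Fin I.q)}
    (hm : Marks (σ.mem 2 0) A) :
    Marks ((bfs.run (residual.run σ)).mem 2 0) A ∧
      IsAdj {e | I.label e ∉ A} ((bfs.run (residual.run σ)).mem 3) ∧
      IsBfs I.n I.s ((bfs.run (residual.run σ)).mem 3) ((bfs.run (residual.run σ)).mem 4 0)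
        ((bfs.run (residual.run σ)).mem 5 0) := by
  have hb := bfs.agree_run (residual.run σ)
  have hI' : Loaded I (residual.run σ) := hI.of_agree (residual.agree_run σ) (by decide)
  have hC := residual_run hI.n
  rw [hb.2 2 (by decide), hb.2 3 (by decide), (residual.agree_run σ).2 2 (by decide)]
  refine ⟨hm, hm.isAdj ?_, bfs_run hI'.n hI'.s I.s.2⟩
  rwa [hI.entry] at hC

/-- The walk is built backwards from `t`: each traced vertex prepends one edge and marks its label.
-/
theorem mark_run {σ : Store} (hI : Loaded I σ) {k h : ℕ} {S : Set I.Edge} {A : Set (Fin I.q)}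
    (H : AtStageOne k h S A σ.mem) (hDt : σ.mem 4 0 I.t ≠ 0) :
    ∃ P : List I.Edge, I.Walk S I.s I.t P ∧ P.length + 1 = σ.mem 4 0 I.t ∧
      Marks (((trace mark).run σ).mem 2 0) (A ∪ I.labels {f | f ∈ P}) := by
  have hL := H.search.toLayered
  have key := trace_run (c := mark) (by decide) (by decide) hI.n hI.s hI.t I.t.2 hL hDt
    (fun v m => ∀ hv : v < I.n, ∃ P : List I.Edge, I.Walk S ⟨v, hv⟩ I.t P ∧
      P.length + σ.mem 4 0 v = σ.mem 4 0 I.t ∧ Marks (m 2 0) (A ∪ I.labels {f | f ∈ P}))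
    (fun _ => ⟨[], .nil _, by simp, by simpa [labels] using H.marks⟩) ?_
  · obtain ⟨P, h1, h2, h3⟩ := key I.s.2
    rw [hL.root] at h2
    exact ⟨P, h1, h2, h3⟩
  · intro ρ v hA hvn h2 h8 hJ hP
    obtain ⟨P, hwalk, hlen, hmarks⟩ := hJ hvn
    obtain ⟨_, hPD, hR⟩ := hL.pred v hvn h2
    obtain ⟨e, heS, hj⟩ := (H.adj ⟨_, hP⟩ ⟨v, hvn⟩).2.1 hR
    have hent : I.entry (σ.mem 5 0 v) v = I.label e + 1 := entry_eq hj
    have m0 : ρ.mem 0 = I.entry := (hA.2 0 (by decide)).trans hI.entry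
    have m5 : ρ.mem 5 = σ.mem 5 := hA.2 5 (by decide)
    refine ⟨e :: P, .cons heS hj hwalk, by rw [List.length_cons]; omega, ?_⟩
    have hrow : (mark.run ρ).mem 2 0 =
        fun x : ℕ => if x = (I.label e : ℕ) + 1 then 1 else ρ.mem 2 0 x := by
      funext x
      simp [mark, Prog.run, Expr.eval, Store.putMem, m0, m5, h8, hent]
    rw [hrow]
    refine ⟨by simpa using hmarks.1, fun l => ?_⟩
    have hl := hmarks.2 l
    by_cases hle : l = I.label e
    · simp [hle, labels]
    · have hle' : (l : ℕ) ≠ I.label e := fun h => hle (Fin.ext h)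
      simp only [Nat.add_right_cancel_iff, hle', if_false, hl]
      simp [labels, Ne.symm hle]

/-- A round either finds the loop over and changes nothing in the state, or performs one iteration.
The short walk recorded in the second case shows that a loop once over stays over. -/
theorem stageOneBody_run {σ : Store} (hI : Loaded I σ) {h : ℕ} {S : Set I.Edge}
    {A : Set (Fin I.q)} (H : AtStageOne (σ.var 10 + 1) h S A σ.mem) :
    (AtStageOne (σ.var 10 + 1) h S A (stageOneBody.run σ).mem ∧
      ∀ P, I.Walk S I.s I.t P → I.threshold (σ.var 10 + 1) < (P.length : ℝ)) ∨
    (∃ P, I.Walk S I.s I.t P ∧ (P.length : ℝ) ≤ I.threshold (σ.var 10 + 1)) ∧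
      ∃ (S' : Set I.Edge) (A' : Set (Fin I.q)),
        AtStageOne (σ.var 10 + 1) (h + 1) S' A' (stageOneBody.run σ).mem := by
  obtain ⟨ρ, hρ⟩ : ∃ ρ, ρ = sides.run σ := ⟨_, rfl⟩
  have hA := sides.agree_run σ
  obtain ⟨h12, h13⟩ := sides_run hI.n hI.t (H.search.toLayered.le I.t.2)
  rw [← hρ] at hA h12 h13
  have hIρ : Loaded I ρ := hI.of_agree hA (by decide)
  have m4 : ρ.mem 4 = σ.mem 4 := hA.2 4 (by decide)
  have Hρ : AtStageOne (σ.var 10 + 1) h S A ρ.mem :=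
    H.congr (hA.2 2 (by decide)) (hA.2 3 (by decide)) m4 (hA.2 5 (by decide))
  have hdist : ∀ P, I.Walk S I.s I.t P → σ.mem 4 0 I.t ≠ 0 ∧ σ.mem 4 0 I.t ≤ P.length + 1 := by
    intro P hP
    have hroot := H.search.root
    have := IsBfs.le_length H.adj H.search hP (by omega)
    omega
  have hrun : stageOneBody.run σ = if σ.mem 4 0 I.t ≠ 0 then
      if I.n ^ 2 + 1 - (σ.mem 4 0 I.t - 1) ^ 3 * (σ.var 10 + 1) ≠ 0 then
        bfs.run (residual.run ((trace mark).run ρ)) else ρ else ρ := by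
    simp only [stageOneBody, Prog.run, ← hρ, Expr.eval, hIρ.t, m4, h12, h13]
  rw [hrun]
  split_ifs with h1 h2
  · right
    obtain ⟨P, hP, hlen, hmarks⟩ := mark_run hIρ Hρ (by rwa [m4])
    rw [m4] at hlen
    have hIτ : Loaded I ((trace mark).run ρ) :=
      hIρ.of_agree ((trace mark).agree_run ρ) (by decide)
    obtain ⟨h3, h4, h5⟩ := residual_bfs_run hIτ hmarks
    have hτ : (P.length : ℝ) ≤ I.threshold (σ.var 10 + 1) := by
      refine (le_threshold_iff (Nat.add_one_pos _) _).2 ?_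
      rw [show P.length = σ.mem 4 0 I.t - 1 by omega]
      omega
    have hstage : I.StageOne (σ.var 10 + 1) (h + 1) _ _ := H.stage.step (P := P)
      ⟨hP, fun Q hQ => by
        have := hdist Q hQ
        omega⟩ hτ
    refine ⟨⟨P, hP, hτ⟩, _, _, hstage, h3, ?_, h5⟩
    rw [hstage.eq_compl]
    exact h4
  · refine Or.inl ⟨Hρ, fun P hP => ?_⟩
    by_contra hle
    have hle' := (le_threshold_iff (Nat.add_one_pos _) _).1 (not_lt.1 hle)
    have hlen : σ.mem 4 0 I.t - 1 ≤ P.length := by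
      have := hdist P hP
      omega
    have := Nat.mul_le_mul_right (σ.var 10 + 1) (Nat.pow_le_pow_left hlen 3)
    omega
  · refine Or.inl ⟨Hρ, fun P hP => ?_⟩
    exact absurd (hdist P hP).1 h1

theorem stageOne_run {σ : Store} (hI : Loaded I σ) {S : Set I.Edge} {A : Set (Fin I.q)}
    (H : AtStageOne (σ.var 10 + 1) 0 S A σ.mem) :
    ∃ h S A, AtStageOne (σ.var 10 + 1) h S A (stageOne.run σ).mem ∧
      ∀ P, I.Walk S I.s I.t P → I.threshold (σ.var 10 + 1) < (P.length : ℝ) := by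
  refine Prog.rep_induction
    (fun j ρ => ∃ h S A, AtStageOne (σ.var 10 + 1) h S A ρ.mem ∧
      (h = j ∨ ∀ P, I.Walk S I.s I.t P → I.threshold (σ.var 10 + 1) < (P.length : ℝ)))
    (Q := fun ρ => ∃ h S A, AtStageOne (σ.var 10 + 1) h S A ρ.mem ∧
      ∀ P, I.Walk S I.s I.t P → I.threshold (σ.var 10 + 1) < (P.length : ℝ))
    ⟨0, S, A, H, Or.inl rfl⟩ ?_ ?_
  · rintro j _ ρ hρ ⟨h, S, A, Hh, hj⟩
    have e10 : (ρ.setVar 11 j).var 10 = σ.var 10 := hρ.1 10 (by decide)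
    have hIρ : Loaded I (ρ.setVar 11 j) := (hI.of_agree hρ (by decide)).setVar (by decide) j
    have hbody := stageOneBody_run (σ := ρ.setVar 11 j) hIρ (h := h) (S := S) (A := A)
      (by rw [e10]; exact Hh)
    rw [e10] at hbody
    rcases hbody with ⟨h1, h2⟩ | ⟨⟨P, hP, hτ⟩, S', A', h1⟩
    · exact ⟨h, S, A, h1, Or.inr h2⟩
    · rcases hj with rfl | hj
      · exact ⟨_, S', A', h1, Or.inl rfl⟩
      · exact absurd (hj P hP) (not_lt.2 hτ)
  · rintro ρ hρ ⟨h, S, A, Hh, hj⟩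
    -- Otherwise all `q` rounds were iterations, and one more run of the body would give iteration
    -- `q + 1`, against `StageOne.le_q`.
    by_contra hcon
    have hfar : ¬ ∀ P, I.Walk S I.s I.t P → I.threshold (σ.var 10 + 1) < (P.length : ℝ) :=
      fun hfar => hcon ⟨h, S, A, Hh, hfar⟩
    have e10 : ρ.var 10 = σ.var 10 := hρ.1 10 (by decide)
    have hbody := stageOneBody_run (hI.of_agree hρ (by decide)) (h := h) (S := S) (A := A)
      (by rw [e10]; exact Hh)
    rw [e10] at hbody
    rcases hbody with ⟨_, h2⟩ | ⟨_, S', A', h1⟩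
    · exact hfar h2
    · have := h1.stage.le_q
      have := hj.resolve_right hfar
      have := hI.q
      omega

/-! ### Stage two -/

/-- Stage two can be in the state given by the arrays `m`: the edge set `S` with adjacency matrix
`C` carries a flow of value `f`. -/
structure AtStageTwo (I : Instance) (C : ℕ → ℕ → ℕ) (f : ℕ) (m : ℕ → ℕ → ℕ → ℕ) : Prop where
  flow : I.IsResidual C (m 3) f
  search : IsBfs I.n I.s (m 3) (m 4 0) (m 5 0)

theorem push_bfs_run {σ : Store} (hI : Loaded I σ) {C : ℕ → ℕ → ℕ} {f : ℕ}
    (H : AtStageTwo I C f σ.mem) (hDt : σ.mem 4 0 I.t ≠ 0) :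
    AtStageTwo I C (f + 1) (bfs.run ((trace push).run σ)).mem := by
  have hb := bfs.agree_run ((trace push).run σ)
  have hI' : Loaded I ((trace push).run σ) := hI.of_agree ((trace push).agree_run σ) (by decide)
  refine ⟨fun U hs ht => ?_, ?_⟩
  · rw [hb.2 3 (by decide), ← H.flow U hs ht, ← push_run hI.n hI.s hI.t I.t.2
      H.search.toLayered hDt U I.s.2 hs ht]
    ring
  · rw [hb.2 3 (by decide)]
    exact bfs_run hI'.n hI'.s I.s.2

theorem stageTwo_run {σ : Store} (hI : Loaded I σ) {S : Set I.Edge} (hS : IsAdj S (σ.mem 3))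
    (hb : IsBfs I.n I.s (σ.mem 3) (σ.mem 4 0) (σ.mem 5 0)) :
    (∃ f, AtStageTwo I (σ.mem 3) f (stageTwo.run σ).mem) ∧ (stageTwo.run σ).mem 4 0 I.t = 0 := by
  refine Prog.rep_induction
    (fun j ρ => ∃ f, AtStageTwo I (σ.mem 3) f ρ.mem ∧ (f = j ∨ ρ.mem 4 0 I.t = 0))
    (Q := fun ρ => (∃ f, AtStageTwo I (σ.mem 3) f ρ.mem) ∧ ρ.mem 4 0 I.t = 0)
    ⟨0, ⟨fun _ _ _ => rfl, hb⟩, Or.inl rfl⟩ ?_ ?_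
  · rintro j _ ρ hρ ⟨f, H, hj⟩
    have hIρ : Loaded I (ρ.setVar 11 j) := (hI.of_agree hρ (by decide)).setVar (by decide) j
    have hrun : stageTwoBody.run (ρ.setVar 11 j) = if ρ.mem 4 0 I.t ≠ 0 then
        bfs.run ((trace push).run (ρ.setVar 11 j)) else ρ.setVar 11 j := by
      simp only [stageTwoBody, Prog.run, Expr.eval, hIρ.t]
      rfl
    rw [hrun]
    split_ifs with h
    · exact ⟨f + 1, push_bfs_run hIρ H h, Or.inl (by rw [hj.resolve_right h])⟩
    · exact ⟨f, H, Or.inr (not_not.1 h)⟩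
  · rintro ρ hρ ⟨f, H, hj⟩
    refine ⟨⟨f, H⟩, ?_⟩
    -- Otherwise all `n` rounds augmented, and one more would give a flow of value `n + 1` through
    -- the cut `{s}` of capacity at most `n`.
    by_contra hne
    have h1 := (push_bfs_run (hI.of_agree hρ (by decide)) H hne).flow {I.s} rfl
      fun h => I.s_ne_t (Set.mem_singleton_iff.1 h).symm
    have h2 := hS.capacity_source_le
    have h3 := hj.resolve_right hne
    have h4 := hI.n
    omega

/-! ### One guess -/

theorem solve_run {σ : Store} (hI : Loaded I σ) :
    ∃ X, I.Run (σ.var 10 + 1) X ∧ Marks ((solve.run σ).mem 2 0) X := by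
  obtain ⟨ρ₁, hρ₁⟩ : ∃ ρ, ρ = clear.run σ := ⟨_, rfl⟩
  obtain ⟨ρ₂, hρ₂⟩ : ∃ ρ, ρ = bfs.run (residual.run ρ₁) := ⟨_, rfl⟩
  obtain ⟨ρ₃, hρ₃⟩ : ∃ ρ, ρ = stageOne.run ρ₂ := ⟨_, rfl⟩
  obtain ⟨ρ₄, hρ₄⟩ : ∃ ρ, ρ = stageTwo.run ρ₃ := ⟨_, rfl⟩
  have hrun : solve.run σ = markCut.run ρ₄ := by
    rw [hρ₄, hρ₃, hρ₂, hρ₁]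
    rfl
  have hA₁ := clear.agree_run σ
  rw [← hρ₁] at hA₁
  have hI₁ : Loaded I ρ₁ := hI.of_agree hA₁ (by decide)
  have hA₂ := (Prog.seq residual bfs).agree_run ρ₁
  rw [show (Prog.seq residual bfs).run ρ₁ = ρ₂ from hρ₂.symm] at hA₂
  have hI₂ : Loaded I ρ₂ := hI₁.of_agree hA₂ (by decide)
  have hA₃ := stageOne.agree_run ρ₂
  rw [← hρ₃] at hA₃
  have hI₃ : Loaded I ρ₃ := hI₂.of_agree hA₃ (by decide)
  have hA₄ := stageTwo.agree_run ρ₃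
  rw [← hρ₄] at hA₄
  have hI₄ : Loaded I ρ₄ := hI₃.of_agree hA₄ (by decide)
  have hclear := clear_run hI.q
  rw [← hρ₁] at hclear
  have hstart := residual_bfs_run hI₁ (A := ∅) ⟨hclear.1, fun l => by simp [hclear.2 l l.2]⟩
  rw [← hρ₂] at hstart
  have e10 : ρ₂.var 10 = σ.var 10 := (hA₂.1 10 (by decide)).trans (hA₁.1 10 (by decide))
  obtain ⟨h, S, A, H, hfar⟩ := stageOne_run hI₂ (S := Set.univ) (A := ∅)
    ⟨.start, hstart.1, by simpa using hstart.2.1, hstart.2.2⟩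
  rw [← hρ₃, e10] at H
  rw [e10] at hfar
  obtain ⟨⟨f, Hf⟩, ht⟩ := stageTwo_run hI₃ H.adj H.search
  rw [← hρ₄] at Hf ht
  have hS := H.stage.eq_compl
  obtain ⟨U, hU⟩ : ∃ U : Set (Fin I.n), U = {v : Fin I.n | ρ₄.mem 4 0 v ≠ 0} := ⟨_, rfl⟩
  have hmem : ∀ v : Fin I.n, v ∈ U ↔ ρ₄.mem 4 0 v ≠ 0 := fun v => by rw [hU]; rfl
  have hcut : I.IsMinCut S (crossing S U) := by
    refine H.adj.isMinCut Hf.flow ((hmem _).2 ?_) (fun h => (hmem _).1 h ht) fun u hu v hv => ?_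
    · rw [Hf.search.root]
      exact one_ne_zero
    · by_contra hne
      exact hv ((hmem v).2 (Hf.search.closed u u.2 v v.2 ((hmem u).1 hu) hne).1)
  refine ⟨A ∪ I.labels (crossing S U), ⟨h, S, A, _, H.stage, hfar, hcut, rfl⟩, ?_⟩
  have hmark := markCut_run hI₄.n
  rw [← hrun, hA₄.2 2 (by decide), hI₄.entry] at hmark
  refine ⟨(hmark 0).2 (Or.inl H.marks.1), fun l => ?_⟩
  rw [hmark, H.marks.2, Set.mem_union]
  constructor
  · rintro (hl | ⟨u, hu, v, hv, h1, h2, h3⟩)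
    · exact Or.inl hl
    -- `markCut` reads the original matrix, so it may meet an edge removed in stage one; the label
    -- of such an edge is already in `A`.
    · by_cases hl : l ∈ A
      · exact Or.inl hl
      · obtain ⟨e, he⟩ := entry_ne_zero (u := ⟨u, hu⟩) (v := ⟨v, hv⟩) (I := I) (by
          change I.entry u v ≠ 0
          omega)
        have hle : I.label e = l := by
          have h4 : I.entry u v = I.label e + 1 := entry_eq he
          exact Fin.ext (by omega)
        refine Or.inr ⟨e, ⟨?_, _, _, he, (hmem _).2 h1, fun h => (hmem _).1 h h2⟩, hle⟩
        rw [hS]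
        exact fun h => hl (hle ▸ h)
  · rintro (hl | ⟨e, ⟨_, u, v, hj, hu, hv⟩, rfl⟩)
    · exact Or.inl hl
    · refine Or.inr ⟨u, u.2, v, v.2, (hmem u).1 hu, ?_, entry_eq hj⟩
      by_contra hne
      exact hv ((hmem v).2 hne)

/-! ### All guesses -/

theorem main_run (I : Instance) : I.Returns (I.output (main.run I.input)) := by
  obtain ⟨σ, hσ⟩ : ∃ σ : Store, σ = I.input.setVar 14 (I.q + 1) := ⟨_, rfl⟩
  have hI : Loaded I σ := by
    rw [hσ]
    exact ⟨rfl, rfl, rfl, rfl, rfl⟩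
  have hrun : main.run I.input = (Prog.rep 10 1 mainBody).run σ := by
    rw [hσ]
    rfl
  rw [hrun]
  refine Prog.rep_induction
    (fun i ρ => ∃ Y : ℕ → Set (Fin I.q), (∀ k ∈ Finset.Icc 1 i, I.Run k (Y k)) ∧
      (∀ j ∈ Finset.Icc 1 i, ρ.var 14 ≤ (Y j).ncard) ∧
      (i = 0 ∧ ρ.var 14 = I.q + 1 ∨
        ∃ k ∈ Finset.Icc 1 i, I.output ρ = Y k ∧ ρ.var 14 = (Y k).ncard))
    (Q := fun ρ => I.Returns (I.output ρ)) ?_ ?_ ?_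
  · exact ⟨fun _ => ∅, by simp, by simp, Or.inl ⟨rfl, by simp [hσ, Store.setVar]⟩⟩
  · rintro i _ ρ hρ ⟨Y, hY, hmin, hbest⟩
    have hIρ : Loaded I (ρ.setVar 10 i) := (hI.of_agree hρ (by decide)).setVar (by decide) i
    obtain ⟨X, hX, hmarks⟩ := solve_run hIρ
    obtain ⟨ρ', hρ'⟩ : ∃ ρ', ρ' = count.run (solve.run (ρ.setVar 10 i)) := ⟨_, rfl⟩
    have hA := (Prog.seq solve count).agree_run (ρ.setVar 10 i)
    rw [show (Prog.seq solve count).run (ρ.setVar 10 i) = ρ' from hρ'.symm] at hA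
    have hI' : Loaded I ρ' := hIρ.of_agree hA (by decide)
    have hIs : Loaded I (solve.run (ρ.setVar 10 i)) :=
      hIρ.of_agree (solve.agree_run _) (by decide)
    have h15 : ρ'.var 15 = X.ncard := by
      rw [hρ', count_run hIs.q, hmarks.sum_eq]
    have h14 : ρ'.var 14 = ρ.var 14 := hA.1 14 (by decide)
    have h1 : ρ'.mem 1 = ρ.mem 1 := hA.2 1 (by decide)
    have h2 : ρ'.mem 2 = (solve.run (ρ.setVar 10 i)).mem 2 := by
      rw [hρ', (count.agree_run _).2 2 (by decide)]
    have hbody : mainBody.run (ρ.setVar 10 i) =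
        if ρ.var 14 - X.ncard ≠ 0 then save.run ρ' else ρ' := by
      have hsub : (Expr.sub (.var 14) (.var 15)).eval ρ' = ρ.var 14 - X.ncard := by
        simp only [Expr.eval, h14, h15]
      rw [← hsub, mainBody, Prog.run_seq, Prog.run_seq, ← hρ']
      split_ifs with h
      exacts [Prog.run_ite_of_ne _ _ h, Prog.run_ite_of_eq _ _ (not_not.1 h)]
    have hX' : I.Run (i + 1) X := by
      have e10 : (ρ.setVar 10 i).var 10 = i := rfl
      rwa [e10] at hX
    have hold : ∀ k ∈ Finset.Icc 1 i, Function.update Y (i + 1) X k = Y k := fun k hk => by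
      rw [Finset.mem_Icc] at hk
      exact Function.update_of_ne (by omega) _ _
    have hIcc : Finset.Icc 1 (i + 1) = insert (i + 1) (Finset.Icc 1 i) :=
      (Finset.insert_Icc_right_eq_Icc_add_one (by omega)).symm
    refine ⟨Function.update Y (i + 1) X, ?_, ?_⟩
    · rw [hIcc]
      intro k hk
      rcases Finset.mem_insert.1 hk with rfl | hk
      · rwa [Function.update_self]
      · rw [hold k hk]
        exact hY k hk
    · rw [hbody, hIcc]
      split_ifs with hlt
      · obtain ⟨h3, h4⟩ := save_run hI'.q
        rw [h15] at h3
        refine ⟨fun j hj => ?_, Or.inr ⟨i + 1, Finset.mem_insert_self _ _, ?_, ?_⟩⟩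
        · rcases Finset.mem_insert.1 hj with rfl | hj
          · rw [h3, Function.update_self]
          · rw [h3, hold j hj]
            have := hmin j hj
            omega
        · rw [Function.update_self]
          ext l
          change (save.run ρ').mem 1 0 l ≠ 0 ↔ l ∈ X
          rw [h4 l l.2, h2, hmarks.2]
        · rw [h3, Function.update_self]
      · rw [h14]
        refine ⟨fun j hj => ?_, Or.inr ?_⟩
        · rcases Finset.mem_insert.1 hj with rfl | hj
          · rw [Function.update_self]
            omega
          · rw [hold j hj]
            exact hmin j hj
        -- The initial value `q + 1` cannot survive a round, as `X` has at most `q` labels.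
        · rcases hbest with ⟨_, hb⟩ | ⟨k, hk, hk1, hk2⟩
          · have := ncard_label_le X
            omega
          · refine ⟨k, Finset.mem_insert_of_mem hk, ?_, ?_⟩
            · rw [hold k hk, ← hk1]
              ext l
              simp only [output, h1]
            · rw [hold k hk, hk2]
  · rintro ρ _ ⟨Y, hY, hmin, hbest⟩
    rw [hI.q] at hY hmin hbest
    rcases hbest with ⟨hq, _⟩ | ⟨k, hk, hk1, hk2⟩
    · exact absurd hq I.q_pos.ne'
    · exact ⟨Y, hY, k, hk, hk1, fun j hj => hk2 ▸ hmin j hj⟩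

end Program

end LabelCut

/-! ### The program runs in polynomial time -/

namespace LabelCut

theorem Instance.exec_main : ∃ (prog : Ram.Cmd) (c d : ℕ), ∀ I : Instance,
    ∃ (T : ℕ) (σ : Ram.Store),
      Ram.Exec prog I.input T σ ∧ T ≤ c * (I.n + I.q) ^ d ∧ I.Returns (I.output σ) := by
  obtain ⟨c, d, hcd⟩ := Program.main.exists_time_le
  refine ⟨Program.main.compile, c * 2 ^ d, d, fun I => ?_⟩
  obtain ⟨T, hT, hexec⟩ := Program.main.exec_compile (I.n + I.q) Program.main_bounded
    (by decide) (by decide) I.input (Nat.le_add_right _ _) (Nat.le_add_left _ _)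
  refine ⟨T, _, hexec, (hT.trans (hcd _)).trans ?_, Program.main_run I⟩
  -- The factor `2 ^ d` absorbs `n + q + 1 ≤ 2 * (n + q)`, valid since `n ≥ 1`.
  rw [mul_assoc, ← mul_pow]
  have := I.n_pos
  exact Nat.mul_le_mul_left c (Nat.pow_le_pow_left (by omega) d)

end LabelCut

theorem mainTheorem3 :
    -- approximation guarantee, for all choices of shortest paths and minimum cuts
    (∃ C : ℝ, 0 < C ∧ ∀ I : LabelCut.Instance,
      (∀ X, 0 < I.opt → I.Run I.opt X → I.IsLabelCut X ∧ I.WithinRatio C X) ∧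
      (∀ X, I.Returns X → I.IsLabelCut X ∧ (0 < I.opt → I.WithinRatio C X) ∧
        (I.opt = 0 → X = ∅))) ∧
    -- whatever the guess and the choices, the while loop stops
    (∀ (I : LabelCut.Instance) (k : ℕ), 0 < k →
      ∀ h S A, I.StageOne k h S A → h ≤ I.q) ∧
    -- the algorithm is carried out by one program in polynomial time
    (∃ (prog : Ram.Cmd) (c d : ℕ), ∀ I : LabelCut.Instance, ∃ (T : ℕ) (σ : Ram.Store),
      Ram.Exec prog I.input T σ ∧ T ≤ c * (I.n + I.q) ^ d ∧ I.Returns (I.output σ)) := by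
  refine ⟨⟨2, two_pos, fun I => ⟨fun X hpos h => ⟨h.isLabelCut, h.withinRatio hpos⟩,
    fun X h => ?_⟩⟩, fun _ _ _ _ _ _ H => H.le_q, LabelCut.Instance.exec_main⟩
  obtain ⟨k, hk⟩ := h.exists_run
  exact ⟨hk.isLabelCut, fun hpos => h.withinRatio hpos, fun hopt => hk.eq_empty hopt⟩
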